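/- **Setting.** Write $(t)u$ for application of pure $\lambda$-terms (up to $\alpha$-equivalence), $(t)u_1\dots u_n$ for $(\dots((t)u_1)\dots)u_n$, $\simeq_\beta$ for $\beta$-equivalence, and $u\succ v$ if $v$ is obtained from $u$ by finitely many (possibly zero) steps of head reduction, i.e. contraction of $(\lambda x\,u)v$ in $\lambda x_1\dots\lambda x_k\,(\lambda x\,u)v\,v_1\dots v_m$. The Church integers are $\underline n=\lambda x\lambda f\,(f)^n x$. A closed $\lambda$-term $T$ is a *storage operator for the integers* if for every $n\ge 0$ there is $\tau_n\simeq_\beta\underline n$ such that for every $\theta_n\simeq_\beta\underline n$ and every variable $f$ there is a simultaneous substitution $\sigma$ of $\lambda$-terms for variables with $(T)\theta_n f\succ(f)\sigma(\tau_n)$. Let $L$ be a first-order language (function and predicate symbols) with a constant $0$ and a unary function symbol $s$, and let $E$ be a set of (universally quantified) equations between terms of $L$ such that $s(a)=0$ is never an equational consequence of $E$, and if $s(a)=s(b)$ is one then so is $a=b$. The formulas of $AF2_\perp$ are built with $\perp$, $\to$ and $\forall$ from the atoms $R(\bar t)$ ($R$ a predicate symbol of $L$), $X(\bar t)$ and $X_\perp(\bar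 t)$, where for every arity there are ordinary predicate variables $X$ and special ones $X_\perp$, called $\perp$-variables; one can quantify over individual variables, ordinary predicate variables and $\perp$-variables. Let $\neg A$ be $A\to\perp$. The *$\perp$-types* are the least class of formulas containing $\perp$ and all $X_\perp(\bar t)$, containing $A\to B$ whenever it contains $B$, and closed under all three quantifiers. The judgement $\Gamma\vdash_\perp t:A$ is generated by: - $\Gamma\vdash_\perp x:A$ if $x:A$ is in $\Gamma$; if $\Gamma,x:A\vdash_\perp t:B$ then $\Gamma\vdash_\perp\lambda x\,t:A\to B$; if $\Gamma\vdash_\perp t:A\to B$ and $\Gamma\vdash_\perp u:A$ then $\Gamma\vdash_\perp(t)u:B$; - if $\Gamma\vdash_\perp t:A$ and the variable $v$ (of any of the three sorts) is not free in $\Gamma$, then $\Gamma\vdash_\perp t:\forall v\,A$; - from $\Gamma\vdash_\perp t:\forall x\,A$ infer $\Gamma\vdash_\perp t:A[a/x]$ for any term $a$; from $\Gamma\vdash_\perp t:\forall X\,A$ infer $\Gamma\vdash_\perp t:A[G/X]$ for any formula $G$; from $\Gamma\vdash_\perp t:\forall X_\perp A$ infer $\Gamma\vdash_\perp t:A[G/X_\perp]$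 for any $\perp$-type $G$; - from $\Gamma\vdash_\perp t:A[a/x]$ infer $\Gamma\vdash_\perp t:A[b/x]$ if $a=b$ is an equational consequence of $E$. Put $N[x]=\forall X\{X(0),\forall y(X(y)\to X(sy))\to X(x)\}$ and $N^\perp[x]=\forall X_\perp\{X_\perp(0),\forall y(X_\perp(y)\to X_\perp(sy))\to X_\perp(x)\}$, with $X$ and $X_\perp$ unary. For a formula $G$ ending in $\perp$ (i.e. $G$ is $\perp$, or $A\to B$ with $B$ ending in $\perp$, or a quantification of a formula ending in $\perp$), with a distinguished individual variable, and for ordinary predicate variables $X_1,\dots,X_r$ of any arities, put $N^g[x]=\forall X_1\dots\forall X_r\{G[0],\forall y(G[y]\to G[sy])\to G[x]\}$. (The simple Gödel translation $N^*[x]$ is the case $G[x]=X(x)\to\perp$, and the translation $N^e[x]$ the case $G[x]=X_1(x),\dots,X_r(x)\to\perp$.) Let $\underline s=\lambda n\lambda x\lambda f\,(f)((n)x)f$, $\underline s'=\lambda n\lambda x\lambda f\,((n)(f)x)f$, $T_1=\lambda n\,((n)\delta)H$ with $\delta=\lambda f\,(f)\underline 0$ and $H=\lambda x\lambda y\,(x)\lambda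 z\,(y)(\underline s)z$, and, for $c\in\{\underline s,\underline s'\}$, $T_2^{c}=\lambda n\lambda f\,(((n)f)F_c)\underline 0$ with $F_c=\lambda x\lambda y\,(x)(c)y$. For closed $S,S'$ let $$T_S=\lambda\nu\lambda f\,((\nu)(S)\nu f)\lambda x\,x,\qquad T'_{S,S'}=\lambda\nu\lambda f\,((\nu)(S)\nu f)\lambda d\,(S')\nu f .$$ **Theorem 5.1.** 1. If $T$ is a closed $\lambda$-term with $\vdash_\perp T:\forall x\{N^\perp[x]\to\neg\neg N[x]\}$, then $T$ is a storage operator for the integers. 2. For all $S,S'\in\{T_1,T_2^{\underline s'}\}$, the terms $T_S$ and $T'_{S,S'}$ have type $\forall x\{N^\perp[x]\to\neg\neg N[x]\}$ in the empty context. 3. For all $S,S'\in\{T_1,T_2^{\underline s},T_2^{\underline s'}\}$ and every choice of $X_1,\dots,X_r$ and $G$ ending in $\perp$ as above, neither $T_S$ nor $T'_{S,S'}$ has type $\forall x\{N^g[x]\to\neg\neg N[x]\}$ in the empty context, even in $AF2_\perp$ (hence not in its subsystem $AF2$, which has no $\perp$-variables). -/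

import Mathlib

universe u v

namespace AF2

/-! ### The pure λ-calculus (de Bruijn indices: λ-terms up to α-equivalence) -/

/-- Pure λ-terms. `var i` refers to the `i`-th enclosing binder, and to a free variable when there
are at most `i` of them. -/
inductive Lam : Type
  | var (i : ℕ) : Lam
  | app (t u : Lam) : Lam
  | lam (t : Lam) : Lam

namespace Lam

def upRen (ρ : ℕ → ℕ) : ℕ → ℕ
  | 0 => 0
  | i + 1 => ρ i + 1

def rename : (ℕ → ℕ) → Lam → Lam
  | ρ, var i => var (ρ i)
  | ρ, app t u => app (rename ρ t) (rename ρ u)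
  | ρ, lam t => lam (rename (upRen ρ) t)

def up (σ : ℕ → Lam) : ℕ → Lam
  | 0 => var 0
  | i + 1 => rename Nat.succ (σ i)

/-- Simultaneous capture-avoiding substitution `σ(t)`. -/
def subst : (ℕ → Lam) → Lam → Lam
  | σ, var i => σ i
  | σ, app t u => app (subst σ t) (subst σ u)
  | σ, lam t => lam (subst (up σ) t)

def single (u : Lam) : ℕ → Lam
  | 0 => u
  | i + 1 => var i

/-- `inst t u` is the contractum `t[u/x]` of the redex `(λx t) u`. -/
def inst (t u : Lam) : Lam := subst (single u) t

def FreeIn : ℕ → Lam → Prop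
  | i, var j => i = j
  | i, app t u => FreeIn i t ∨ FreeIn i u
  | i, lam t => FreeIn (i + 1) t

def Closed (t : Lam) : Prop := ∀ i, ¬ FreeIn i t

inductive BetaStep : Lam → Lam → Prop
  | beta (t u : Lam) : BetaStep (app (lam t) u) (inst t u)
  | appLeft {t t' : Lam} (u : Lam) : BetaStep t t' → BetaStep (app t u) (app t' u)
  | appRight (t : Lam) {u u' : Lam} : BetaStep u u' → BetaStep (app t u) (app t u')
  | lam {t t' : Lam} : BetaStep t t' → BetaStep (lam t) (lam t')

/-- β-equivalence. -/
def BetaEq : Lam → Lam → Prop := Relation.EqvGen BetaStep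

/-- One step of head reduction: contraction of the redex `(λx u) v` in
`λx₁ … λxₙ (λx u) v v₁ … vₘ`. -/
inductive HeadStep : Lam → Lam → Prop
  | beta (t u : Lam) : HeadStep (app (lam t) u) (inst t u)
  | app {t u w : Lam} (v : Lam) : HeadStep (app t u) w → HeadStep (app (app t u) v) (app w v)
  | lam {t t' : Lam} : HeadStep t t' → HeadStep (lam t) (lam t')

/-- `u ≻ v`: `v` is obtained from `u` by some (possibly zero) steps of head reduction. -/
def HeadRed : Lam → Lam → Prop := Relation.ReflTransGen HeadStep

/-- The Church integer `λx λf (f)ⁿ x`. -/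
def church (n : ℕ) : Lam := lam (lam ((fun t => app (var 0) t)^[n] (var 1)))

/-- `T` is a storage operator for the Church integers. -/
def IsStorageOperator (T : Lam) : Prop :=
  Closed T ∧ ∀ n : ℕ, ∃ τ : Lam, BetaEq τ (church n) ∧
    ∀ θ : Lam, BetaEq θ (church n) → ∀ f : ℕ, ∃ σ : ℕ → Lam,
      HeadRed (app (app T θ) (var f)) (app (var f) (subst σ τ))

/-- `λn λx λf (f)((n)x)f` -/
def succ : Lam := lam (lam (lam (app (var 0) (app (app (var 2) (var 1)) (var 0)))))

/-- `λn λx λf ((n)(f)x)f` -/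
def succ' : Lam := lam (lam (lam (app (app (var 2) (app (var 0) (var 1))) (var 0))))

/-- `λn ((n)δ)G` with `δ = λf (f)0` and `G = λx λy (x)λz (y)(s)z`, for a closed term `s`. -/
def storage₁ (s : Lam) : Lam :=
  lam (app (app (var 0) (lam (app (var 0) (church 0))))
    (lam (lam (app (var 1) (lam (app (var 1) (app s (var 0))))))))

/-- `λn λf (((n)f)F)0` with `F = λx λy (x)(s)y`, for a closed term `s`. -/
def storage₂ (s : Lam) : Lam :=
  lam (lam (app (app (app (var 1) (var 0)) (lam (lam (app (var 1) (app s (var 0)))))) (church 0)))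

/-- `λν λf ((ν)(S)νf) λx x`, for a closed term `S`. -/
def opT (S : Lam) : Lam :=
  lam (lam (app (app (var 1) (app (app S (var 1)) (var 0))) (lam (var 0))))

/-- `λν λf ((ν)(S)νf) λd (S')νf`, for closed terms `S`, `S'`. -/
def opT' (S S' : Lam) : Lam :=
  lam (lam (app (app (var 1) (app (app S (var 1)) (var 0)))
    (lam (app (app S' (var 2)) (var 1)))))

end Lam

/-! ### Second order formulas

Individual terms are Mathlib's first order terms over `L` with variables in `ℕ`. All variables of
formulas are de Bruijn indices; individual variables, and predicate variables of each kind and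
each arity, are indexed separately. -/

/-- The two kinds of predicate variables: ordinary ones and ⊥-variables. -/
inductive Kind : Type
  | ordinary : Kind
  | bottom : Kind
  deriving DecidableEq

inductive Formula (L : FirstOrder.Language.{u, v}) : Type (max u v)
  | bot : Formula L
  | rel {n : ℕ} (R : L.Relations n) (ts : Fin n → L.Term ℕ) : Formula L
  | pvar (k : Kind) (n : ℕ) (i : ℕ) (ts : Fin n → L.Term ℕ) : Formula L
  | imp (A B : Formula L) : Formula L
  | all₁ (A : Formula L) : Formula L
  | all₂ (k : Kind) (n : ℕ) (A : Formula L) : Formula L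

namespace Formula

variable {L : FirstOrder.Language.{u, v}}

/-- `¬A` -/
def neg (A : Formula L) : Formula L := imp A bot

def up₁ (σ : ℕ → L.Term ℕ) : ℕ → L.Term ℕ
  | 0 => FirstOrder.Language.Term.var 0
  | i + 1 => (σ i).relabel Nat.succ

/-- Simultaneous substitution of terms for the individual variables. -/
def subst₁ : (ℕ → L.Term ℕ) → Formula L → Formula L
  | _, bot => bot
  | σ, rel R ts => rel R (fun j => (ts j).subst σ)
  | σ, pvar k n i ts => pvar k n i (fun j => (ts j).subst σ)
  | σ, imp A B => imp (subst₁ σ A) (subst₁ σ B)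
  | σ, all₁ A => all₁ (subst₁ (up₁ σ) A)
  | σ, all₂ k n A => all₂ k n (subst₁ σ A)

def single₁ (t : L.Term ℕ) : ℕ → L.Term ℕ
  | 0 => t
  | i + 1 => FirstOrder.Language.Term.var i

/-- `A[t/x]`, where `x` is the individual variable `0`, which disappears. -/
def inst₁ (A : Formula L) (t : L.Term ℕ) : Formula L := subst₁ (single₁ t) A

/-- Weakening by a fresh individual variable `0`. -/
def shift₁ (A : Formula L) : Formula L := subst₁ (fun i => FirstOrder.Language.Term.var (i + 1)) A

def upRen₂ (k : Kind) (n : ℕ) (ρ : Kind → ℕ → ℕ → ℕ) : Kind → ℕ → ℕ → ℕ := fun k' n' i =>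
  if k' = k ∧ n' = n then
    match i with
    | 0 => 0
    | i + 1 => ρ k' n' i + 1
  else ρ k' n' i

/-- Renaming of the predicate variables. -/
def rename₂ : (Kind → ℕ → ℕ → ℕ) → Formula L → Formula L
  | _, bot => bot
  | _, rel R ts => rel R ts
  | ρ, pvar k n i ts => pvar k n (ρ k n i) ts
  | ρ, imp A B => imp (rename₂ ρ A) (rename₂ ρ B)
  | ρ, all₁ A => all₁ (rename₂ ρ A)
  | ρ, all₂ k n A => all₂ k n (rename₂ (upRen₂ k n ρ) A)

/-- Weakening by a fresh predicate variable `0` of kind `k` and arity `n`. -/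
def shift₂ (k : Kind) (n : ℕ) (A : Formula L) : Formula L :=
  rename₂ (fun k' n' i => if k' = k ∧ n' = n then i + 1 else i) A

/-- In a formula `G` that is to be substituted for an `n`-ary predicate variable, the individual
variables `0, …, n-1` are the places of the arguments, and `n + j` is the individual variable `j`
of the formula into which `G` is substituted. `G.applyArgs ts` puts the terms `ts` into the
places. -/
def applyArgs {n : ℕ} (G : Formula L) (ts : Fin n → L.Term ℕ) : Formula L :=
  subst₁ (fun m => if h : m < n then ts ⟨m, h⟩ else FirstOrder.Language.Term.var (m - n)) G

/-- The formula `X(x₀, …, xₙ₋₁)`, substituted for an `n`-ary variable. -/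
def idArg (k : Kind) (n i : ℕ) : Formula L :=
  pvar k n i (fun j => FirstOrder.Language.Term.var (j : ℕ))

def up₂₁ (Θ : Kind → ℕ → ℕ → Formula L) : Kind → ℕ → ℕ → Formula L := fun k n i =>
  subst₁ (fun m => FirstOrder.Language.Term.var (if m < n then m else m + 1)) (Θ k n i)

def up₂₂ (k : Kind) (n : ℕ) (Θ : Kind → ℕ → ℕ → Formula L) : Kind → ℕ → ℕ → Formula L :=
  fun k' n' i =>
    if k' = k ∧ n' = n then
      match i with
      | 0 => idArg k' n' 0
      | i + 1 => shift₂ k n (Θ k' n' i)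
    else shift₂ k n (Θ k' n' i)

/-- Simultaneous substitution of formulas for the predicate variables. -/
def subst₂ : (Kind → ℕ → ℕ → Formula L) → Formula L → Formula L
  | _, bot => bot
  | _, rel R ts => rel R ts
  | Θ, pvar k n i ts => (Θ k n i).applyArgs ts
  | Θ, imp A B => imp (subst₂ Θ A) (subst₂ Θ B)
  | Θ, all₁ A => all₁ (subst₂ (up₂₁ Θ) A)
  | Θ, all₂ k n A => all₂ k n (subst₂ (up₂₂ k n Θ) A)

def single₂ (k : Kind) (n : ℕ) (G : Formula L) : Kind → ℕ → ℕ → Formula L := fun k' n' i =>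
  if k' = k ∧ n' = n then
    match i with
    | 0 => G
    | i + 1 => idArg k' n' i
  else idArg k' n' i

/-- `A[G/X]`, where `X` is the predicate variable `0` of kind `k` and arity `n`, which
disappears. -/
def inst₂ (k : Kind) (n : ℕ) (A G : Formula L) : Formula L := subst₂ (single₂ k n G) A

/-- The ⊥-types: formulas ending in `⊥` or in an atom of a ⊥-variable. -/
def IsBotType : Formula L → Prop
  | bot => True
  | rel _ _ => False
  | pvar k _ _ _ => k = Kind.bottom
  | imp _ B => IsBotType B
  | all₁ A => IsBotType A
  | all₂ _ _ A => IsBotType A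

/-- The formulas ending in `⊥`. -/
def EndsInBot : Formula L → Prop
  | bot => True
  | rel _ _ => False
  | pvar _ _ _ _ => False
  | imp _ B => EndsInBot B
  | all₁ A => EndsInBot A
  | all₂ _ _ A => EndsInBot A

end Formula

section System

variable {L : FirstOrder.Language.{u, v}}

/-- Equational consequence: derivability of `u = v` from the (universally quantified) equations of
`E`. -/
inductive EqCons (E : Set (L.Term ℕ × L.Term ℕ)) : L.Term ℕ → L.Term ℕ → Prop
  | ax {a b : L.Term ℕ} (h : (a, b) ∈ E) (σ : ℕ → L.Term ℕ) : EqCons E (a.subst σ) (b.subst σ)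
  | refl (a : L.Term ℕ) : EqCons E a a
  | symm {a b : L.Term ℕ} : EqCons E a b → EqCons E b a
  | trans {a b c : L.Term ℕ} : EqCons E a b → EqCons E b c → EqCons E a c
  | congr {n : ℕ} (f : L.Functions n) {as bs : Fin n → L.Term ℕ} :
      (∀ j, EqCons E (as j) (bs j)) →
        EqCons E (FirstOrder.Language.Term.func f as) (FirstOrder.Language.Term.func f bs)

/-- The typing judgement `Γ ⊢_⊥ t : A` of `AF2_⊥` relative to a set of equations `E`; the `i`-th
formula of the list `Γ` is the type of the variable `i`. -/
inductive Typing (E : Set (L.Term ℕ × L.Term ℕ)) :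
    List (Formula L) → Lam → Formula L → Prop
  | var {Γ : List (Formula L)} {i : ℕ} {A : Formula L} : Γ[i]? = some A → Typing E Γ (Lam.var i) A
  | lam {Γ : List (Formula L)} {t : Lam} {A B : Formula L} :
      Typing E (A :: Γ) t B → Typing E Γ (Lam.lam t) (Formula.imp A B)
  | app {Γ : List (Formula L)} {t u : Lam} {A B : Formula L} :
      Typing E Γ t (Formula.imp A B) → Typing E Γ u A → Typing E Γ (Lam.app t u) B
  | gen₁ {Γ : List (Formula L)} {t : Lam} {A : Formula L} :
      Typing E (Γ.map Formula.shift₁) t A → Typing E Γ t (Formula.all₁ A)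
  | spec₁ {Γ : List (Formula L)} {t : Lam} {A : Formula L} (a : L.Term ℕ) :
      Typing E Γ t (Formula.all₁ A) → Typing E Γ t (A.inst₁ a)
  | gen₂ {Γ : List (Formula L)} {t : Lam} {A : Formula L} (k : Kind) (n : ℕ) :
      Typing E (Γ.map (Formula.shift₂ k n)) t A → Typing E Γ t (Formula.all₂ k n A)
  | spec₂ {Γ : List (Formula L)} {t : Lam} {A : Formula L} {n : ℕ} (G : Formula L) :
      Typing E Γ t (Formula.all₂ Kind.ordinary n A) →
        Typing E Γ t (A.inst₂ Kind.ordinary n G)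
  | specBot {Γ : List (Formula L)} {t : Lam} {A : Formula L} {n : ℕ} (G : Formula L) :
      Typing E Γ t (Formula.all₂ Kind.bottom n A) → G.IsBotType →
        Typing E Γ t (A.inst₂ Kind.bottom n G)
  | eqn {Γ : List (Formula L)} {t : Lam} (A : Formula L) {a b : L.Term ℕ} :
      Typing E Γ t (A.inst₁ a) → EqCons E a b → Typing E Γ t (A.inst₁ b)

/-! ### The types of integers, for a constant `z` (zero) and a unary function symbol `s` -/

variable (z : L.Functions 0) (s : L.Functions 1)

def zeroT : L.Term ℕ := FirstOrder.Language.Term.func z Fin.elim0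

def succT (a : L.Term ℕ) : L.Term ℕ := FirstOrder.Language.Term.func s (fun _ => a)

/-- `E` is adequate with the type of integers. -/
def Adequate (E : Set (L.Term ℕ × L.Term ℕ)) : Prop :=
  (∀ a, ¬ EqCons E (succT s a) (zeroT z)) ∧
    ∀ a b, EqCons E (succT s a) (succT s b) → EqCons E a b

/-- `∀X {X(0), ∀y (X(y) → X(sy)) → X(a)}` with `X` a unary predicate variable of kind `k`. -/
def natOfKind (k : Kind) (a : L.Term ℕ) : Formula L :=
  Formula.all₂ k 1 (Formula.imp (Formula.pvar k 1 0 fun _ => zeroT z)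
    (Formula.imp
      (Formula.all₁ (Formula.imp (Formula.pvar k 1 0 fun _ => FirstOrder.Language.Term.var 0)
        (Formula.pvar k 1 0 fun _ => succT s (FirstOrder.Language.Term.var 0))))
      (Formula.pvar k 1 0 fun _ => a)))

/-- `N[a]` -/
def nat (a : L.Term ℕ) : Formula L := natOfKind z s Kind.ordinary a

/-- `N^⊥[a]` -/
def natBot (a : L.Term ℕ) : Formula L := natOfKind z s Kind.bottom a

/-- `∀X₁ … ∀Xᵣ {G[0], ∀y (G[y] → G[sy]) → G[a]}`: the formula obtained from `N[a]` by replacing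
each atom `X(t)` by `G[t/x]`, and the quantifier on `X` by quantifiers on predicate variables of
arities `ns = [n₁, …, nᵣ]`. In `G` the individual variable `0` is the distinguished variable `x`,
and `j + 1` is the individual variable `j` outside. -/
def natGodel (ns : List ℕ) (G : Formula L) (a : L.Term ℕ) : Formula L :=
  ns.foldr (Formula.all₂ Kind.ordinary)
    (Formula.imp (G.inst₁ (zeroT z))
      (Formula.imp
        (Formula.all₁ (Formula.imp G
          (G.subst₁ fun m => if m = 0 then succT s (FirstOrder.Language.Term.var 0)
            else FirstOrder.Language.Term.var m)))
        (G.inst₁ a)))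

/-- `∀x {N^⊥[x] → ¬¬N[x]}` -/
def storageType : Formula L :=
  Formula.all₁ (Formula.imp (natBot z s (FirstOrder.Language.Term.var 0))
    (nat z s (FirstOrder.Language.Term.var 0)).neg.neg)

/-- `∀x {N^g[x] → ¬¬N[x]}`, for the translation `g` given by `ns` and `G`. -/
def storageTypeGodel (ns : List ℕ) (G : Formula L) : Formula L :=
  Formula.all₁ (Formula.imp (natGodel z s ns G (FirstOrder.Language.Term.var 0))
    (nat z s (FirstOrder.Language.Term.var 0)).neg.neg)

end System

end AF2

namespace AF2

namespace Lam

/-! ### Substitution -/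

/-! The negative claims and the storage property both come from realizability. Formulas denote sets
of λ-terms closed under weak head expansion, individuals range over terms modulo `E`, and a `Pole`
fixes the set for ⊥ and a reduction `Step` extending weak head reduction. Ordinary variables range
over sets closed under weak head expansion, ⊥-variables only over sets closed under
`Step`-expansion. Since ⊥-types denote sets of the latter sort (`sem_bottom`), typing is sound
(`Typing.sound`).

Storage: the variable 1 plays an unknown θₙ. `CodeStep` lets `(1)a b` become a reserved variable
indexed by `(n, a, b)`, and lets these variables unfold as iterations of `b` on `a`. By these rules
the variable 1 realizes N^⊥[sⁿ0]. If ⊥ is the set of terms reducing to `(0)τ` with τ equivalent to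
the Church integer n, the variable 0 realizes ¬N[sⁿ0], because realizers of N[sⁿ0] are equivalent to
that integer (`betaEq_church_of_mem_nat`). So `(T)1 0` lies in ⊥, which fixes τ before any θ is
chosen. For a given θ, substituting pieces of its own weak head computation for the reserved
variables turns every `CodeStep` into weak head reduction (`CodeStep.restore`). Such pieces exist
because every term equivalent to a Church integer computes it by weak head reduction, a
standardization fact proved by factoring parallel reduction.

Positive typings: taking ⊥ for the ⊥-variable gives ν the type ⊥, ∀y(⊥ → ⊥) → ⊥, so the outer
iteration of ν is typable whatever it iterates.

Negative typings: in the term model an individual variable is not a numeral, so N of it has no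
realizer and every term realizes its negation. A typing would then put `(T)0 1` in ⊥ whenever the
variable 0 realizes N^g. But `(T)0 1` reduces to `(0)a b` with exactly two arguments. If G is ∀…∀⊥,
take ⊥ empty. Otherwise G expects an argument, and ⊥ is the set of terms reducing to the variable 0
with at least three arguments. Either choice is contradictory, and S, S' play no role. -/

theorem upRen_comp (ρ ρ' : ℕ → ℕ) : upRen ρ' ∘ upRen ρ = upRen (ρ' ∘ ρ) := by
  funext i; cases i <;> rfl

theorem rename_rename (t : Lam) : ∀ ρ ρ' : ℕ → ℕ,
    rename ρ' (rename ρ t) = rename (ρ' ∘ ρ) t := by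
  induction t with
  | var i => intro ρ ρ'; rfl
  | app t u iht ihu => intro ρ ρ'; simp [rename, iht, ihu]
  | lam t ih => intro ρ ρ'; simp [rename, ih, upRen_comp]

theorem up_comp_upRen (ρ : ℕ → ℕ) (σ : ℕ → Lam) : up σ ∘ upRen ρ = up (σ ∘ ρ) := by
  funext i; cases i <;> rfl

theorem subst_rename (t : Lam) : ∀ (ρ : ℕ → ℕ) (σ : ℕ → Lam),
    subst σ (rename ρ t) = subst (σ ∘ ρ) t := by
  induction t with
  | var i => intro ρ σ; rfl
  | app t u iht ihu => intro ρ σ; simp [rename, subst, iht, ihu]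
  | lam t ih => intro ρ σ; simp [rename, subst, ih, up_comp_upRen]

theorem up_rename (ρ : ℕ → ℕ) (σ : ℕ → Lam) :
    (fun i => rename (upRen ρ) (up σ i)) = up (fun i => rename ρ (σ i)) := by
  funext i
  cases i with
  | zero => rfl
  | succ i => simp only [up, rename_rename]; rfl

theorem rename_subst (t : Lam) : ∀ (ρ : ℕ → ℕ) (σ : ℕ → Lam),
    rename ρ (subst σ t) = subst (fun i => rename ρ (σ i)) t := by
  induction t with
  | var i => intro ρ σ; rfl
  | app t u iht ihu => intro ρ σ; simp [rename, subst, iht, ihu]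
  | lam t ih => intro ρ σ; simp [rename, subst, ih, up_rename]

theorem up_subst (σ σ' : ℕ → Lam) :
    (fun i => subst (up σ') (up σ i)) = up (fun i => subst σ' (σ i)) := by
  funext i
  cases i with
  | zero => rfl
  | succ i => simp only [up, subst_rename, rename_subst]; rfl

theorem subst_subst (t : Lam) : ∀ (σ σ' : ℕ → Lam),
    subst σ' (subst σ t) = subst (fun i => subst σ' (σ i)) t := by
  induction t with
  | var i => intro ρ σ; rfl
  | app t u iht ihu => intro ρ σ; simp [subst, iht, ihu]
  | lam t ih => intro ρ σ; simp [subst, ih, up_subst]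

theorem up_var : up var = var := by
  funext i; cases i <;> rfl

theorem subst_var (t : Lam) : subst var t = t := by
  induction t with
  | var i => rfl
  | app t u iht ihu => simp [subst, iht, ihu]
  | lam t ih => simp [subst, up_var, ih]

theorem up_var_comp (ρ : ℕ → ℕ) : up (fun i => var (ρ i)) = fun i => var (upRen ρ i) := by
  funext i; cases i <;> rfl

theorem rename_eq_subst (t : Lam) : ∀ ρ : ℕ → ℕ, rename ρ t = subst (fun i => var (ρ i)) t := by
  induction t with
  | var i => intro ρ; rfl
  | app t u iht ihu => intro ρ; simp [rename, subst, iht, ihu]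
  | lam t ih => intro ρ; simp [rename, subst, ih, up_var_comp]

theorem subst_congr (t : Lam) : ∀ {σ σ' : ℕ → Lam},
    (∀ i, FreeIn i t → σ i = σ' i) → subst σ t = subst σ' t := by
  induction t with
  | var i => intro σ σ' h; exact h i rfl
  | app t u iht ihu =>
    intro σ σ' h
    simp only [subst]
    rw [iht fun i hi => h i (Or.inl hi), ihu fun i hi => h i (Or.inr hi)]
  | lam t ih =>
    intro σ σ' h
    simp only [subst]
    rw [ih]
    intro i hi
    cases i with
    | zero => rfl
    | succ i => simp only [up]; rw [h i hi]

theorem rename_congr {t : Lam} {ρ ρ' : ℕ → ℕ} (h : ∀ i, FreeIn i t → ρ i = ρ' i) :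
    rename ρ t = rename ρ' t := by
  rw [rename_eq_subst, rename_eq_subst]
  exact subst_congr t fun i hi => by rw [h i hi]

theorem Closed.subst_eq {t : Lam} (ht : Closed t) (σ : ℕ → Lam) : subst σ t = t := by
  rw [subst_congr t (σ' := var) fun i hi => absurd hi (ht i), subst_var]

/-- Extension of a substitution by a value for the variable `0`. -/
def cons (u : Lam) (σ : ℕ → Lam) : ℕ → Lam
  | 0 => u
  | i + 1 => σ i

theorem inst_subst_up (t u : Lam) (σ : ℕ → Lam) :
    inst (subst (up σ) t) u = subst (cons u σ) t := by
  rw [inst, subst_subst]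
  congr 1
  funext i
  cases i with
  | zero => rfl
  | succ i =>
    simp only [up, subst_rename, cons]
    exact subst_var _

theorem subst_inst (t u : Lam) (σ : ℕ → Lam) :
    subst σ (inst t u) = inst (subst (up σ) t) (subst σ u) := by
  rw [inst_subst_up, inst, subst_subst]
  congr 1
  funext i
  cases i <;> rfl

theorem rename_inst (t u : Lam) (ρ : ℕ → ℕ) :
    rename ρ (inst t u) = inst (rename (upRen ρ) t) (rename ρ u) := by
  simp only [rename_eq_subst, subst_inst, up_var_comp]

/-! ### Weak head reduction -/

inductive WStep : Lam → Lam → Prop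
  | beta (t u : Lam) : WStep (app (lam t) u) (inst t u)
  | app {t t' : Lam} (u : Lam) : WStep t t' → WStep (app t u) (app t' u)

/-- `WRed t u`: weak head reduction from `t` leads to `u`. -/
def WRed : Lam → Lam → Prop := Relation.ReflTransGen WStep

theorem WStep.headStep {t t' : Lam} (h : WStep t t') : HeadStep t t' := by
  induction h with
  | beta t u => exact .beta t u
  | app u h ih =>
    -- `HeadStep.app` demands an application in function position; a term with a weak head step
    -- always is one.
    cases h with
    | beta a b => exact .app u ih
    | app b h => exact .app u ih

theorem WRed.headRed {t t' : Lam} (h : WRed t t') : HeadRed t t' :=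
  Relation.ReflTransGen.mono (fun _ _ => WStep.headStep) _ _ h

theorem WStep.betaStep {t t' : Lam} (h : WStep t t') : BetaStep t t' := by
  induction h with
  | beta t u => exact .beta t u
  | app u h ih => exact .appLeft u ih

theorem WRed.betaEq {t t' : Lam} (h : WRed t t') : BetaEq t t' := by
  induction h with
  | refl => exact .refl _
  | tail _ h ih => exact .trans _ _ _ ih (.rel _ _ h.betaStep)

theorem WRed.app {t t' : Lam} (h : WRed t t') (u : Lam) : WRed (app t u) (app t' u) :=
  Relation.ReflTransGen.lift (Lam.app · u) (fun _ _ => WStep.app u) _ _ h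

theorem WStep.subst {t t' : Lam} (h : WStep t t') (σ : ℕ → Lam) :
    WStep (subst σ t) (subst σ t') := by
  induction h with
  | beta t u => rw [subst_inst]; exact .beta _ _
  | app u h ih => exact .app _ ih

theorem WRed.subst {t t' : Lam} (h : WRed t t') (σ : ℕ → Lam) :
    WRed (subst σ t) (subst σ t') :=
  Relation.ReflTransGen.lift (Lam.subst σ) (fun _ _ h => WStep.subst h σ) _ _ h

theorem WRed.rename {t t' : Lam} (h : WRed t t') (ρ : ℕ → ℕ) :
    WRed (rename ρ t) (rename ρ t') := by
  rw [rename_eq_subst, rename_eq_subst]; exact h.subst _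

/-- Renaming creates no redex, so reductions of a renamed term can be pulled back. -/
theorem WStep.of_rename {ρ : ℕ → ℕ} {t u : Lam} (h : WStep (Lam.rename ρ t) u) :
    ∃ t', WStep t t' ∧ u = Lam.rename ρ t' := by
  induction t generalizing u with
  | var i => cases h
  | lam t => cases h
  | app t v iht _ =>
    cases t with
    | var i => simp only [Lam.rename] at h; cases h with | app _ h => cases h
    | lam t =>
      simp only [Lam.rename] at h
      cases h with
      | beta => exact ⟨_, .beta _ _, (rename_inst _ _ _).symm⟩
      | app _ h => cases h
    | app a b =>
      simp only [Lam.rename] at h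
      cases h with
      | app _ h =>
        obtain ⟨t', h1, rfl⟩ := iht (u := _) h
        exact ⟨_, .app _ h1, rfl⟩

theorem WRed.of_rename {ρ : ℕ → ℕ} {t u : Lam} (h : WRed (Lam.rename ρ t) u) :
    ∃ t', WRed t t' ∧ u = Lam.rename ρ t' := by
  induction h with
  | refl => exact ⟨t, .refl, rfl⟩
  | tail _ h ih =>
    obtain ⟨t', h1, rfl⟩ := ih
    obtain ⟨t'', h2, rfl⟩ := h.of_rename
    exact ⟨t'', h1.tail h2, rfl⟩

/-- Either only the function part has moved, or it has become an abstraction and the outer redex has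
been contracted. -/
theorem WRed.app_inv {t u v : Lam} (h : WRed (Lam.app t u) v) :
    (∃ t', v = Lam.app t' u ∧ WRed t t') ∨ ∃ a, WRed t (lam a) ∧ WRed (inst a u) v := by
  induction h with
  | refl => exact .inl ⟨t, rfl, .refl⟩
  | tail _ h ih =>
    rcases ih with ⟨t', rfl, h1⟩ | ⟨a, h1, h2⟩
    · cases h with
      | beta a => exact .inr ⟨a, h1, .refl⟩
      | app _ h => exact .inl ⟨_, rfl, h1.tail h⟩
    · exact .inr ⟨a, h1, h2.tail h⟩

theorem WRed.eq_of_var {i : ℕ} {u : Lam} (h : WRed (var i) u) : u = var i := by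
  rcases Relation.ReflTransGen.cases_head h with h | ⟨_, h, _⟩
  · exact h.symm
  · cases h

theorem WRed.eq_of_app_var {i : ℕ} {a u : Lam} (h : WRed (Lam.app (var i) a) u) :
    u = Lam.app (var i) a := by
  rcases h.app_inv with ⟨t', rfl, h'⟩ | ⟨b, h', _⟩
  · rw [h'.eq_of_var]
  · cases h'.eq_of_var

theorem WStep.deterministic {t u v : Lam} (h : WStep t u) (h' : WStep t v) : u = v := by
  induction h generalizing v with
  | beta a b =>
    cases h' with
    | beta => rfl
    | app _ h => cases h
  | app b h ih =>
    cases h' with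
    | beta => cases h
    | app _ h2 => rw [ih h2]

theorem WRed.confluent {t u v : Lam} (h : WRed t u) (h' : WRed t v) : WRed u v ∨ WRed v u := by
  induction h with
  | refl => exact .inl h'
  | tail _ h2 ih =>
    rcases ih with ih | ih
    · rcases Relation.ReflTransGen.cases_head ih with rfl | ⟨w, hw, hr⟩
      · exact .inr (.single h2)
      · rw [h2.deterministic hw]; exact .inl hr
    · exact .inr (ih.tail h2)

/-! ### Parallel reduction -/

inductive Par : Lam → Lam → Prop
  | var (i : ℕ) : Par (var i) (var i)
  | app {t t' u u' : Lam} : Par t t' → Par u u' → Par (app t u) (app t' u')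
  | lam {t t' : Lam} : Par t t' → Par (lam t) (lam t')
  | beta {t t' u u' : Lam} : Par t t' → Par u u' → Par (app (lam t) u) (inst t' u')

theorem Par.refl (t : Lam) : Par t t := by
  induction t with
  | var i => exact .var i
  | app t u iht ihu => exact .app iht ihu
  | lam t ih => exact .lam ih

theorem BetaStep.par {t t' : Lam} (h : BetaStep t t') : Par t t' := by
  induction h with
  | beta t u => exact .beta (.refl _) (.refl _)
  | appLeft u _ ih => exact .app ih (.refl _)
  | appRight t _ ih => exact .app (.refl _) ih
  | lam _ ih => exact .lam ih

theorem Par.rename {t t' : Lam} (h : Par t t') : ∀ ρ, Par (rename ρ t) (rename ρ t') := by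
  induction h with
  | var i => intro ρ; exact .refl _
  | app _ _ ih1 ih2 => intro ρ; exact .app (ih1 ρ) (ih2 ρ)
  | lam _ ih => intro ρ; exact .lam (ih _)
  | beta _ _ ih1 ih2 => intro ρ; rw [rename_inst]; exact .beta (ih1 _) (ih2 ρ)

theorem Par.up {σ σ' : ℕ → Lam} (h : ∀ i, Par (σ i) (σ' i)) (i : ℕ) :
    Par (up σ i) (up σ' i) := by
  cases i with
  | zero => exact .var 0
  | succ i => exact (h i).rename _

theorem Par.subst {t t' : Lam} (h : Par t t') : ∀ {σ σ' : ℕ → Lam},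
    (∀ i, Par (σ i) (σ' i)) → Par (subst σ t) (subst σ' t') := by
  induction h with
  | var i => intro σ σ' hσ; exact hσ i
  | app _ _ ih1 ih2 => intro σ σ' hσ; exact .app (ih1 hσ) (ih2 hσ)
  | lam _ ih => intro σ σ' hσ; exact .lam (ih (Par.up hσ))
  | beta _ _ ih1 ih2 => intro σ σ' hσ; rw [subst_inst]; exact .beta (ih1 (Par.up hσ)) (ih2 hσ)

theorem Par.single {u u' : Lam} (h : Par u u') (i : ℕ) : Par (single u i) (single u' i) := by
  cases i with
  | zero => exact h
  | succ i => exact .var i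

theorem Par.inst {t t' u u' : Lam} (h : Par t t') (hu : Par u u') :
    Par (inst t u) (inst t' u') := h.subst hu.single

/-- Parallel reduction that does not contract the weak head redex. -/
inductive IPar : Lam → Lam → Prop
  | var (i : ℕ) : IPar (var i) (var i)
  | app {t t' u u' : Lam} : IPar t t' → Par u u' → IPar (app t u) (app t' u')
  | lam {t t' : Lam} : Par t t' → IPar (lam t) (lam t')

/-- Parallel reduction that factors as weak head reduction followed by internal parallel
reduction. -/
def FPar (t t' : Lam) : Prop := Par t t' ∧ ∃ w, WRed t w ∧ IPar w t'

theorem FPar.app {t t' u u' : Lam} (h : FPar t t') (hu : Par u u') :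
    FPar (Lam.app t u) (Lam.app t' u') := by
  obtain ⟨h, w, h1, h2⟩ := h
  exact ⟨.app h hu, _, h1.app u, .app h2 hu⟩

/-- Substituting at the head may expose new weak head steps, so the values must factor as well;
inside arguments and abstractions their `Par` component suffices. -/
theorem IPar.fpar_subst {t t' : Lam} (h : IPar t t') {σ σ' : ℕ → Lam}
    (hσ : ∀ i, FPar (σ i) (σ' i)) : FPar (subst σ t) (subst σ' t') := by
  induction h with
  | var i => exact hσ i
  | app _ hu ih => exact ih.app (hu.subst fun i => (hσ i).1)
  | lam h =>
    have := h.subst (Par.up fun i => (hσ i).1)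
    exact ⟨.lam this, _, .refl, .lam this⟩

theorem FPar.subst {t t' : Lam} (h : FPar t t') {σ σ' : ℕ → Lam}
    (hσ : ∀ i, FPar (σ i) (σ' i)) : FPar (Lam.subst σ t) (Lam.subst σ' t') := by
  obtain ⟨h, w, h1, h2⟩ := h
  obtain ⟨_, w', h3, h4⟩ := h2.fpar_subst hσ
  exact ⟨h.subst fun i => (hσ i).1, w', (h1.subst σ).trans h3, h4⟩

/-- Standardization for one parallel step; in the β case stability of `FPar` under substitution
handles the contractum. -/
theorem Par.fpar {t t' : Lam} (h : Par t t') : FPar t t' := by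
  induction h with
  | var i => exact ⟨.var i, _, .refl, .var i⟩
  | app _ hu ih _ => exact ih.app hu
  | lam h _ => exact ⟨.lam h, _, .refl, .lam h⟩
  | @beta t t' u u' ht hu ih1 ih2 =>
    have h : FPar (Lam.inst t u) (Lam.inst t' u') := by
      refine ih1.subst fun i => ?_
      cases i with
      | zero => exact ih2
      | succ i => exact ⟨.var i, _, .refl, .var i⟩
    obtain ⟨_, w, h1, h2⟩ := h
    exact ⟨.beta ht hu, w, Relation.ReflTransGen.head (.beta t u) h1, h2⟩

/-- An internal step cannot create the weak head redex: the abstraction contracted afterwards was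
already an abstraction. -/
theorem IPar.postpone {t t' u' : Lam} (h : IPar t t') (hs : WStep t' u') :
    ∃ u, WStep t u ∧ Par u u' := by
  induction h generalizing u' with
  | var i => cases hs
  | lam h => cases hs
  | app ht hu ih =>
    cases hs with
    | beta a b =>
      cases ht with
      | lam h => exact ⟨_, .beta _ _, h.inst hu⟩
    | app _ hs =>
      obtain ⟨w, h1, h2⟩ := ih hs
      exact ⟨_, .app _ h1, .app h2 hu⟩

theorem Par.wRed_left {t t' u' : Lam} (h : Par t t') (hr : WRed t' u') :
    ∃ u, WRed t u ∧ Par u u' := by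
  induction hr with
  | refl => exact ⟨t, .refl, h⟩
  | tail _ hs ih =>
    obtain ⟨u, h1, h2⟩ := ih
    obtain ⟨_, w, h3, h4⟩ := h2.fpar
    obtain ⟨u', h5, h6⟩ := h4.postpone hs
    exact ⟨u', (Relation.ReflTransGen.trans h1 h3).tail h5, h6⟩

theorem Par.wStep_right {t t' u : Lam} (h : Par t t') (hs : WStep t u) :
    ∃ u', WRed t' u' ∧ Par u u' := by
  induction h generalizing u with
  | var i => cases hs
  | lam h => cases hs
  | app ht hu ih _ =>
    cases hs with
    | beta a b =>
      cases ht with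
      | lam h => exact ⟨_, .single (.beta _ _), h.inst hu⟩
    | app _ hs =>
      obtain ⟨w, h1, h2⟩ := ih hs
      exact ⟨_, h1.app _, .app h2 hu⟩
  | beta ht hu _ _ =>
    cases hs with
    | beta a b => exact ⟨_, .refl, ht.inst hu⟩
    | app _ hs => cases hs

theorem Par.wRed_right {t t' u : Lam} (h : Par t t') (hr : WRed t u) :
    ∃ u', WRed t' u' ∧ Par u u' := by
  induction hr with
  | refl => exact ⟨t', .refl, h⟩
  | tail _ hs ih =>
    obtain ⟨u', h1, h2⟩ := ih
    obtain ⟨v', h3, h4⟩ := h2.wStep_right hs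
    exact ⟨v', Relation.ReflTransGen.trans h1 h3, h4⟩

/-! ### Weak head reduction of the terms equivalent to a Church integer -/

/-- `u` computes `(q)ᵐ p` by weak head reduction, at every level. -/
def Iterates (p q : ℕ) : ℕ → Lam → Prop
  | 0, u => WRed u (var p)
  | m + 1, u => ∃ u', WRed u (app (var q) u') ∧ Iterates p q m u'

/-- `t` computes the Church integer `n` by weak head reduction, at every level. -/
def ComputesChurch (n : ℕ) (t : Lam) : Prop :=
  ∃ a b, WRed t (lam a) ∧ WRed a (lam b) ∧ Iterates 1 0 n b

theorem Iterates.wRed {p q n : ℕ} {t u : Lam} (h : WRed t u) (hu : Iterates p q n u) :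
    Iterates p q n t := by
  cases n with
  | zero => exact Relation.ReflTransGen.trans h hu
  | succ n =>
    obtain ⟨u', h1, h2⟩ := hu
    exact ⟨u', Relation.ReflTransGen.trans h h1, h2⟩

theorem Iterates.rename {p q n : ℕ} {t : Lam} (h : Iterates p q n t) (ρ : ℕ → ℕ) :
    Iterates (ρ p) (ρ q) n (Lam.rename ρ t) := by
  induction n generalizing t with
  | zero => exact WRed.rename h ρ
  | succ n ih =>
    obtain ⟨u, h1, h2⟩ := h
    exact ⟨_, h1.rename ρ, ih h2⟩

theorem Iterates.par {p q n : ℕ} {t t' : Lam} (h : Par t t') :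
    Iterates p q n t ↔ Iterates p q n t' := by
  induction n generalizing t t' with
  | zero =>
    constructor
    · intro hr
      obtain ⟨u, h1, h2⟩ := h.wRed_right hr
      cases h2; exact h1
    · intro hr
      obtain ⟨u, h1, h2⟩ := h.wRed_left hr
      obtain ⟨_, w, h3, h4⟩ := h2.fpar
      cases h4; exact Relation.ReflTransGen.trans h1 h3
  | succ n ih =>
    constructor
    · rintro ⟨u, hr, hu⟩
      obtain ⟨w, h1, h2⟩ := h.wRed_right hr
      cases h2 with
      | app h2 h3 => cases h2; exact ⟨_, h1, (ih h3).1 hu⟩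
    · rintro ⟨u, hr, hu⟩
      obtain ⟨v, h1, h2⟩ := h.wRed_left hr
      obtain ⟨_, w, h3, h4⟩ := h2.fpar
      cases h4 with
      | app h4 h5 => cases h4; exact ⟨_, Relation.ReflTransGen.trans h1 h3, (ih h5).2 hu⟩

theorem Par.lam_right {t t' a : Lam} (h : Par t t') (hr : WRed t (Lam.lam a)) :
    ∃ a', WRed t' (Lam.lam a') ∧ Par a a' := by
  obtain ⟨u, h1, h2⟩ := h.wRed_right hr
  cases h2 with
  | lam h2 => exact ⟨_, h1, h2⟩

theorem Par.lam_left {t t' a' : Lam} (h : Par t t') (hr : WRed t' (Lam.lam a')) :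
    ∃ a, WRed t (Lam.lam a) ∧ Par a a' := by
  obtain ⟨u, h1, h2⟩ := h.wRed_left hr
  obtain ⟨_, w, h3, h4⟩ := h2.fpar
  cases h4 with
  | lam h4 => exact ⟨_, Relation.ReflTransGen.trans h1 h3, h4⟩

theorem ComputesChurch.par {n : ℕ} {t t' : Lam} (h : Par t t') :
    ComputesChurch n t ↔ ComputesChurch n t' := by
  constructor
  · rintro ⟨a, b, h1, h2, h3⟩
    obtain ⟨a', h1', ha⟩ := h.lam_right h1
    obtain ⟨b', h2', hb⟩ := ha.lam_right h2
    exact ⟨a', b', h1', h2', (Iterates.par hb).1 h3⟩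
  · rintro ⟨a, b, h1, h2, h3⟩
    obtain ⟨a', h1', ha⟩ := h.lam_left h1
    obtain ⟨b', h2', hb⟩ := ha.lam_left h2
    exact ⟨a', b', h1', h2', (Iterates.par hb).2 h3⟩

/-- Parallel steps preserve and reflect the property, so it passes through zigzags of β-steps
without an appeal to confluence. -/
theorem ComputesChurch.betaEq_iff {n : ℕ} {t t' : Lam} (h : BetaEq t t') :
    ComputesChurch n t ↔ ComputesChurch n t' := by
  induction h with
  | rel _ _ h => exact ComputesChurch.par h.par
  | refl => rfl
  | symm _ _ _ ih => exact ih.symm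
  | trans _ _ _ _ _ ih1 ih2 => exact ih1.trans ih2

theorem iterates_iterate (n : ℕ) : Iterates 1 0 n ((fun t => app (var 0) t)^[n] (var 1)) := by
  induction n with
  | zero => exact .refl
  | succ n ih => rw [Function.iterate_succ_apply']; exact ⟨_, .refl, ih⟩

theorem computesChurch_of_betaEq {n : ℕ} {t : Lam} (h : BetaEq t (church n)) :
    ComputesChurch n t :=
  (ComputesChurch.betaEq_iff h).2 ⟨_, _, .refl, .refl, iterates_iterate n⟩

theorem BetaEq.lift {F : Lam → Lam} (hF : ∀ {t t'}, BetaStep t t' → BetaStep (F t) (F t'))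
    {t t' : Lam} (h : BetaEq t t') : BetaEq (F t) (F t') := by
  induction h with
  | rel _ _ h => exact .rel _ _ (hF h)
  | refl => exact .refl _
  | symm _ _ _ ih => exact .symm _ _ ih
  | trans _ _ _ _ _ ih1 ih2 => exact .trans _ _ _ ih1 ih2

theorem Iterates.betaEq {n : ℕ} {t : Lam} (h : Iterates 1 0 n t) :
    BetaEq t ((fun t => app (var 0) t)^[n] (var 1)) := by
  induction n generalizing t with
  | zero => exact WRed.betaEq h
  | succ n ih =>
    obtain ⟨u, h1, h2⟩ := h
    rw [Function.iterate_succ_apply']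
    exact .trans _ _ _ h1.betaEq (BetaEq.lift (BetaStep.appRight _) (ih h2))

theorem ComputesChurch.betaEq {n : ℕ} {t : Lam} (h : ComputesChurch n t) :
    BetaEq t (church n) := by
  obtain ⟨a, b, h1, h2, h3⟩ := h
  exact .trans _ _ _ h1.betaEq (BetaEq.lift BetaStep.lam
    (.trans _ _ _ h2.betaEq (BetaEq.lift BetaStep.lam h3.betaEq)))

/-- Reaching the prescribed results forces both applications to fresh variables to be contracted,
which exposes two abstractions; undoing the renaming recovers reductions of `t` itself. -/
theorem computesChurch_of_iterates_rename {n : ℕ} {t : Lam}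
    (h : Iterates 1 0 n (app (app (rename (· + 2) t) (var 1)) (var 0))) : ComputesChurch n t := by
  have key : ∃ a, WRed (app (rename (· + 2) t) (var 1)) (lam a) ∧
      Iterates 1 0 n (inst a (var 0)) := by
    cases n with
    | zero =>
      rcases WRed.app_inv h with ⟨t', h1, _⟩ | h
      · cases h1
      · exact h
    | succ n =>
      obtain ⟨u, h1, h2⟩ := h
      rcases WRed.app_inv h1 with ⟨t', h1, _⟩ | ⟨a, h3, h4⟩
      · cases h1
        -- With the outer application uncontracted, the iterated argument would be the variable 0
        -- itself, which iterates nothing towards the variable 1.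
        cases n with
        | zero => cases WRed.eq_of_var h2
        | succ n => obtain ⟨_, h2, _⟩ := h2; cases WRed.eq_of_var h2
      · exact ⟨a, h3, u, h4, h2⟩
  obtain ⟨a', h1, h2⟩ := key
  rcases WRed.app_inv h1 with ⟨t', h1, _⟩ | ⟨a, h3, h4⟩
  · cases h1
  obtain ⟨l, h5, h6⟩ := h3.of_rename
  cases l with
  | var => cases h6
  | app => cases h6
  | lam a₀ =>
    cases h6
    have e : inst (rename (upRen (· + 2)) a₀) (var 1) = rename Nat.succ a₀ := by
      rw [inst, subst_rename, rename_eq_subst]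
      congr 1
      funext i
      cases i <;> rfl
    rw [e] at h4
    obtain ⟨l, h7, h8⟩ := h4.of_rename
    cases l with
    | var => cases h8
    | app => cases h8
    | lam b =>
      cases h8
      refine ⟨a₀, b, h5, h7, ?_⟩
      have e : inst (rename (upRen Nat.succ) b) (var 0) = b := by
        rw [inst, subst_rename]
        conv_rhs => rw [← subst_var b]
        congr 1
        funext i
        cases i <;> rfl
      rwa [e] at h2

end Lam

open FirstOrder.Language

/-! ### Realizability -/

/-- A notion of reduction that extends weak head reduction, and a set of terms closed under its
expansions. -/
structure Pole where
  Step : Lam → Lam → Prop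
  bot : Set Lam
  weak {t t' : Lam} : Lam.WStep t t' → Step t t'
  app {t t' : Lam} (u : Lam) : Step t t' → Step (Lam.app t u) (Lam.app t' u)
  expand {t t' : Lam} : Step t t' → t' ∈ bot → t ∈ bot

namespace Pole

/-- The sets of terms over which predicate variables of kind `k` range. -/
def Admits (P : Pole) : Kind → Set Lam → Prop
  | Kind.ordinary, S => ∀ ⦃t t'⦄, Lam.WStep t t' → t' ∈ S → t ∈ S
  | Kind.bottom, S => ∀ ⦃t t'⦄, P.Step t t' → t' ∈ S → t ∈ S

theorem Admits.weak {P : Pole} {k : Kind} {S : Set Lam} (h : P.Admits k S) :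
    P.Admits Kind.ordinary S := by
  cases k with
  | ordinary => exact h
  | bottom => exact fun _ _ hs => h (P.weak hs)

theorem admits_univ (P : Pole) (k : Kind) : P.Admits k Set.univ := by
  cases k <;> exact fun _ _ _ _ => trivial

end Pole

/-- An assignment of sets of terms to the predicate variables. -/
abbrev PredVal (M : Type*) := Kind → (n : ℕ) → ℕ → (Fin n → M) → Set Lam

section Semantics

variable {M : Type*}

def consInd (e : M) (v : ℕ → M) : ℕ → M
  | 0 => e
  | i + 1 => v i

open Classical in
noncomputable def consPred (k : Kind) (n : ℕ) (X : (Fin n → M) → Set Lam) (V : PredVal M) :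
    PredVal M := fun k' n' i =>
  if h : k' = k ∧ n' = n then
    match i with
    | 0 => h.2 ▸ X
    | i + 1 => V k' n' i
  else V k' n' i

theorem consPred_zero (k : Kind) (n : ℕ) (X : (Fin n → M) → Set Lam) (V : PredVal M) :
    consPred k n X V k n 0 = X := by
  simp [consPred]

theorem consPred_succ (k : Kind) (n : ℕ) (X : (Fin n → M) → Set Lam) (V : PredVal M) (i : ℕ) :
    consPred k n X V k n (i + 1) = V k n i := by
  simp [consPred]

theorem consPred_ne {k : Kind} {n : ℕ} (X : (Fin n → M) → Set Lam) (V : PredVal M) {k' : Kind}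
    {n' : ℕ} (h : ¬ (k' = k ∧ n' = n)) (i : ℕ) :
    consPred k n X V k' n' i = V k' n' i := by
  simp [consPred, h]

def PredVal.Admissible (P : Pole) (V : PredVal M) : Prop :=
  ∀ k n i es, P.Admits k (V k n i es)

theorem PredVal.Admissible.cons {P : Pole} {V : PredVal M} (hV : V.Admissible P) {k : Kind} {n : ℕ}
    {X : (Fin n → M) → Set Lam} (hX : ∀ es, P.Admits k (X es)) :
    PredVal.Admissible P (consPred k n X V) := by
  intro k' n' i es
  by_cases h : k' = k ∧ n' = n
  · obtain ⟨rfl, rfl⟩ := h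
    cases i with
    | zero => rw [consPred_zero]; exact hX es
    | succ i => rw [consPred_succ]; exact hV _ _ _ _
  · rw [consPred_ne _ _ h]; exact hV _ _ _ _

variable {L : FirstOrder.Language.{u, v}} [L.Structure M]

/-- The set of realizers of a formula. -/
noncomputable def sem (P : Pole) : Formula L → (ℕ → M) → PredVal M → Set Lam
  | .bot, _, _ => P.bot
  | .rel _ _, _, _ => Set.univ
  | .pvar k n i ts, v, V => V k n i fun j => (ts j).realize v
  | .imp A B, v, V => {t | ∀ u ∈ sem P A v V, Lam.app t u ∈ sem P B v V}
  | .all₁ A, v, V => {t | ∀ e, t ∈ sem P A (consInd e v) V}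
  | .all₂ k n A, v, V => {t | ∀ X : (Fin n → M) → Set Lam, (∀ es, P.Admits k (X es)) →
      t ∈ sem P A v (consPred k n X V)}

variable (P : Pole)

theorem sem_weak (A : Formula L) : ∀ (v : ℕ → M) {V : PredVal M}, V.Admissible P →
    P.Admits Kind.ordinary (sem P A v V) := by
  induction A with
  | bot => exact fun v V hV t t' h => P.expand (P.weak h)
  | rel => exact fun v V hV => P.admits_univ _
  | pvar => exact fun v V hV => (hV _ _ _ _).weak
  | imp A B _ ih => exact fun v V hV t t' h ht u hu => ih v hV (.app u h) (ht u hu)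
  | all₁ A ih => exact fun v V hV t t' h ht e => ih _ hV h (ht e)
  | all₂ k n A ih => exact fun v V hV t t' h ht X hX => ih _ (hV.cons hX) h (ht X hX)

/-- A ⊥-type ends in a set closed under `Step`-expansion, and `Step` is compatible with application,
so the closure climbs through arrows. This justifies `Typing.specBot`. -/
theorem sem_bottom (A : Formula L) (hA : A.IsBotType) : ∀ (v : ℕ → M) {V : PredVal M},
    V.Admissible P → P.Admits Kind.bottom (sem P A v V) := by
  induction A with
  | bot => exact fun v V hV t t' h => P.expand h
  | rel => exact hA.elim
  | pvar k => cases hA; exact fun v V hV => hV _ _ _ _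
  | imp A B _ ih => exact fun v V hV t t' h ht u hu => ih hA v hV (P.app u h) (ht u hu)
  | all₁ A ih => exact fun v V hV t t' h ht e => ih hA _ hV h (ht e)
  | all₂ k n A ih => exact fun v V hV t t' h ht X hX => ih hA _ (hV.cons hX) h (ht X hX)

/-! ### Substitution lemmas for the semantics -/

theorem sem_subst₁ (A : Formula L) : ∀ (σ : ℕ → L.Term ℕ) (v : ℕ → M) (V : PredVal M),
    sem P (A.subst₁ σ) v V = sem P A (fun i => (σ i).realize v) V := by
  induction A with
  | bot => intros; rfl
  | rel => intros; rfl
  | pvar => intros; simp [sem, Formula.subst₁, Term.realize_subst]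
  | imp A B ihA ihB => intros; simp [sem, Formula.subst₁, ihA, ihB]
  | all₁ A ih =>
    intro σ v V
    have (e : M) : (fun i => (Formula.up₁ σ i).realize (consInd e v)) =
        consInd e fun i => (σ i).realize v := by
      funext i
      cases i with
      | zero => rfl
      | succ i => simp only [Formula.up₁, Term.realize_relabel]; rfl
    simp only [sem, Formula.subst₁, ih, this]
  | all₂ k n A ih => intros; simp [sem, Formula.subst₁, ih]

theorem sem_shift₁ (A : Formula L) (e : M) (v : ℕ → M) (V : PredVal M) :
    sem P A.shift₁ (consInd e v) V = sem P A v V := sem_subst₁ P A _ _ V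

theorem sem_inst₁ (A : Formula L) (a : L.Term ℕ) (v : ℕ → M) (V : PredVal M) :
    sem P (A.inst₁ a) v V = sem P A (consInd (a.realize v) v) V := by
  rw [Formula.inst₁, sem_subst₁]
  congr 1
  funext i
  cases i <;> rfl

theorem sem_rename₂ (A : Formula L) : ∀ (ρ : Kind → ℕ → ℕ → ℕ) (v : ℕ → M) (V : PredVal M),
    sem P (A.rename₂ ρ) v V = sem P A v (fun k n i => V k n (ρ k n i)) := by
  induction A with
  | bot => intros; rfl
  | rel => intros; rfl
  | pvar => intros; rfl
  | imp A B ihA ihB => intros; simp [sem, Formula.rename₂, ihA, ihB]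
  | all₁ A ih => intros; simp [sem, Formula.rename₂, ih]
  | all₂ k n A ih =>
    intro ρ v V
    have (X : (Fin n → M) → Set Lam) :
        (fun k' n' i => consPred k n X V k' n' (Formula.upRen₂ k n ρ k' n' i)) =
          consPred k n X (fun k n i => V k n (ρ k n i)) := by
      funext k' n' i
      by_cases h : k' = k ∧ n' = n
      · obtain ⟨rfl, rfl⟩ := h
        cases i <;> simp [Formula.upRen₂, consPred_zero, consPred_succ]
      · simp [Formula.upRen₂, consPred_ne _ _ h, h]
    simp only [sem, Formula.rename₂, ih, this]

theorem sem_shift₂ (A : Formula L) (k : Kind) (n : ℕ) (X : (Fin n → M) → Set Lam) (v : ℕ → M)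
    (V : PredVal M) : sem P (A.shift₂ k n) v (consPred k n X V) = sem P A v V := by
  rw [Formula.shift₂, sem_rename₂]
  congr 1
  funext k' n' i
  by_cases h : k' = k ∧ n' = n
  · obtain ⟨rfl, rfl⟩ := h
    simp [consPred_succ]
  · simp [consPred_ne _ _ h, h]

/-- The valuation that puts `es` into the places of the arguments. -/
def consArgs {n : ℕ} (es : Fin n → M) (v : ℕ → M) : ℕ → M :=
  fun m => if h : m < n then es ⟨m, h⟩ else v (m - n)

theorem sem_applyArgs {n : ℕ} (G : Formula L) (ts : Fin n → L.Term ℕ) (v : ℕ → M)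
    (V : PredVal M) :
    sem P (G.applyArgs ts) v V = sem P G (consArgs (fun j => (ts j).realize v) v) V := by
  rw [Formula.applyArgs, sem_subst₁]
  congr 1
  funext m
  simp only [consArgs]
  split <;> rfl

theorem sem_idArg (k : Kind) (n i : ℕ) (es : Fin n → M) (v : ℕ → M) (V : PredVal M) :
    sem P (Formula.idArg (L := L) k n i) (consArgs es v) V = V k n i es := by
  simp [Formula.idArg, sem, consArgs]

/-- The assignment of predicates defined by formulas. -/
noncomputable def predVal (Θ : Kind → ℕ → ℕ → Formula L) (v : ℕ → M) (V : PredVal M) :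
    PredVal M := fun k n i es => sem P (Θ k n i) (consArgs es v) V

theorem sem_subst₂ (A : Formula L) : ∀ (Θ : Kind → ℕ → ℕ → Formula L) (v : ℕ → M)
    (V : PredVal M), sem P (A.subst₂ Θ) v V = sem P A v (predVal P Θ v V) := by
  induction A with
  | bot => intros; rfl
  | rel => intros; rfl
  | pvar => intros; simp [sem, Formula.subst₂, sem_applyArgs, predVal]
  | imp A B ihA ihB => intros; simp [sem, Formula.subst₂, ihA, ihB]
  | all₁ A ih =>
    intro Θ v V
    have (e : M) : predVal P (Formula.up₂₁ Θ) (consInd e v) V = predVal P Θ v V := by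
      funext k n i es
      rw [predVal, predVal, Formula.up₂₁, sem_subst₁]
      congr 1
      funext m
      simp only [consArgs, Term.realize_var]
      by_cases h : m < n
      · simp [h]
      · have h1 : ¬ m + 1 < n := by omega
        have h2 : m + 1 - n = (m - n) + 1 := by omega
        simp only [h, h1, h2, if_false, dif_neg, not_false_eq_true]; rfl
    simp only [sem, Formula.subst₂, ih, this]
  | all₂ k n A ih =>
    intro Θ v V
    have (X : (Fin n → M) → Set Lam) :
        predVal P (Formula.up₂₂ k n Θ) v (consPred k n X V) =
          consPred k n X (predVal P Θ v V) := by
      funext k' n' i es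
      by_cases h : k' = k ∧ n' = n
      · obtain ⟨rfl, rfl⟩ := h
        cases i with
        | zero => simp [predVal, Formula.up₂₂, sem_idArg, consPred_zero]
        | succ i => simp [predVal, Formula.up₂₂, sem_shift₂, consPred_succ]
      · simp [predVal, Formula.up₂₂, h, consPred_ne _ _ h, sem_shift₂]
    simp only [sem, Formula.subst₂, ih, this]

theorem sem_inst₂ (k : Kind) (n : ℕ) (A G : Formula L) (v : ℕ → M) (V : PredVal M) :
    sem P (A.inst₂ k n G) v V =
      sem P A v (consPred k n (fun es => sem P G (consArgs es v) V) V) := by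
  rw [Formula.inst₂, sem_subst₂]
  congr 1
  funext k' n' i es
  by_cases h : k' = k ∧ n' = n
  · obtain ⟨rfl, rfl⟩ := h
    cases i with
    | zero => simp [predVal, Formula.single₂, consPred_zero]
    | succ i => simp [predVal, Formula.single₂, sem_idArg, consPred_succ]
  · simp [predVal, Formula.single₂, h, consPred_ne _ _ h, sem_idArg]

variable (M) in
/-- `M` satisfies the equations of `E`. -/
def Satisfies (E : Set (L.Term ℕ × L.Term ℕ)) : Prop :=
  ∀ a b, (a, b) ∈ E → ∀ v : ℕ → M, a.realize v = b.realize v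

theorem EqCons.realize_eq {E : Set (L.Term ℕ × L.Term ℕ)} (hM : Satisfies M E) {a b : L.Term ℕ}
    (h : EqCons E a b) (v : ℕ → M) : a.realize v = b.realize v := by
  induction h with
  | ax h σ => simp only [Term.realize_subst]; exact hM _ _ h _
  | refl => rfl
  | symm _ ih => exact ih.symm
  | trans _ _ ih1 ih2 => exact ih1.trans ih2
  | congr f _ ih => simp only [Term.realize_func, ih]

/-- Soundness of realizability. -/
theorem Typing.sound {E : Set (L.Term ℕ × L.Term ℕ)} (hM : Satisfies M E)
    {Γ : List (Formula L)} {t : Lam} {A : Formula L} (h : Typing E Γ t A) :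
    ∀ (v : ℕ → M) {V : PredVal M}, V.Admissible P → ∀ σ : ℕ → Lam,
      (∀ i B, Γ[i]? = some B → σ i ∈ sem P B v V) → Lam.subst σ t ∈ sem P A v V := by
  induction h with
  | var h => exact fun v V hV σ hσ => hσ _ _ h
  | lam _ ih =>
    intro v V hV σ hσ u hu
    -- Closure under weak head expansion reduces the claim to the contractum.
    refine sem_weak P _ v hV (.beta _ _) ?_
    rw [Lam.inst_subst_up]
    refine ih v hV _ fun i B hi => ?_
    cases i with
    | zero => cases hi; exact hu
    | succ i => exact hσ i B hi
  | app _ _ ih1 ih2 => exact fun v V hV σ hσ => ih1 v hV σ hσ _ (ih2 v hV σ hσ)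
  | gen₁ _ ih =>
    intro v V hV σ hσ e
    refine ih _ hV σ fun i B hi => ?_
    rw [List.getElem?_map, Option.map_eq_some_iff] at hi
    obtain ⟨B, hi, rfl⟩ := hi
    rw [sem_shift₁]
    exact hσ i B hi
  | spec₁ a _ ih =>
    intro v V hV σ hσ
    rw [sem_inst₁]
    exact ih v hV σ hσ _
  | gen₂ k n _ ih =>
    intro v V hV σ hσ X hX
    refine ih _ (hV.cons hX) σ fun i B hi => ?_
    rw [List.getElem?_map, Option.map_eq_some_iff] at hi
    obtain ⟨B, hi, rfl⟩ := hi
    rw [sem_shift₂]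
    exact hσ i B hi
  | spec₂ G _ ih =>
    intro v V hV σ hσ
    rw [sem_inst₂]
    exact ih v hV σ hσ _ fun es => sem_weak P G _ hV
  | specBot G _ hG ih =>
    intro v V hV σ hσ
    rw [sem_inst₂]
    exact ih v hV σ hσ _ fun es => sem_bottom P G hG _ hV
  | eqn A _ hab ih =>
    intro v V hV σ hσ
    have := ih v hV σ hσ
    rwa [sem_inst₁, hab.realize_eq hM v, ← sem_inst₁] at this

theorem Typing.sound_closed {E : Set (L.Term ℕ × L.Term ℕ)} (hM : Satisfies M E) {t : Lam}
    {A : Formula L} (h : Typing E [] t A) (v : ℕ → M) {V : PredVal M} (hV : V.Admissible P) :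
    t ∈ sem P A v V := by
  have := h.sound P hM v hV Lam.var (by simp)
  rwa [Lam.subst_var] at this

/-! ### The type of integers -/

variable (z : L.Functions 0) (s : L.Functions 1)

def zeroM : M := Structure.funMap z Fin.elim0

def succM (e : M) : M := Structure.funMap s fun _ => e

theorem realize_zeroT (v : ℕ → M) : (zeroT z).realize v = zeroM z := by
  simp only [zeroT, Term.realize_func, zeroM]
  congr 1
  funext i
  exact i.elim0

theorem mem_sem_natOfKind (k : Kind) (a : L.Term ℕ) (v : ℕ → M) (V : PredVal M) (t : Lam) :
    t ∈ sem P (natOfKind z s k a) v V ↔ ∀ X : M → Set Lam, (∀ e, P.Admits k (X e)) →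
      ∀ x ∈ X (zeroM z), ∀ f, (∀ e, ∀ u ∈ X e, Lam.app f u ∈ X (succM s e)) →
        Lam.app (Lam.app t x) f ∈ X (a.realize v) := by
  simp only [natOfKind, sem, consPred_zero, realize_zeroT, Set.mem_ofPred_eq,
    Term.realize_var, consInd]
  constructor
  · intro h X hX
    exact h (fun es => X (es 0)) fun es => hX _
  · intro h X hX
    exact h (fun e => X fun _ => e) fun e => hX _

/-! ### The term model -/

variable (E : Set (L.Term ℕ × L.Term ℕ))

def eqSetoid : Setoid (L.Term ℕ) := ⟨EqCons E, .refl, .symm, .trans⟩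

/-- The individual terms modulo equational consequence. -/
def TermModel : Type _ := Quotient (eqSetoid E)

variable {E}

def TermModel.mk (a : L.Term ℕ) : TermModel E := Quotient.mk (eqSetoid E) a

theorem TermModel.mk_eq {a b : L.Term ℕ} :
    (TermModel.mk a : TermModel E) = TermModel.mk b ↔ EqCons E a b :=
  ⟨Quotient.exact, fun h => Quotient.sound h⟩

theorem TermModel.exists_mk (e : TermModel E) : ∃ a, TermModel.mk a = e := Quotient.exists_rep e

/-- Functions act on chosen representatives, which is harmless because `EqCons` is a congruence. The
value of `RelMap` does not matter, as `sem` ignores predicate symbols. -/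
noncomputable instance : L.Structure (TermModel E) where
  funMap f es := TermModel.mk (.func f fun j => (es j).exists_mk.choose)
  RelMap _ _ := True

theorem TermModel.funMap_mk {n : ℕ} (f : L.Functions n) (as : Fin n → L.Term ℕ) :
    (Structure.funMap f fun j => (TermModel.mk (as j) : TermModel E)) =
      TermModel.mk (.func f as) :=
  TermModel.mk_eq.2 (.congr f fun j =>
    TermModel.mk_eq.1 (TermModel.exists_mk (TermModel.mk (as j) : TermModel E)).choose_spec)

theorem TermModel.realize_mk (a : L.Term ℕ) (σ : ℕ → L.Term ℕ) :
    a.realize (fun i => (TermModel.mk (σ i) : TermModel E)) = TermModel.mk (a.subst σ) := by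
  induction a with
  | var i => rfl
  | func f as ih => simp only [Term.realize_func, ih, funMap_mk, Term.subst]

theorem TermModel.satisfies : Satisfies (TermModel E) E := by
  intro a b h v
  choose σ hσ using fun i => (v i).exists_mk
  have e : v = fun i => TermModel.mk (σ i) := funext fun i => (hσ i).symm
  rw [e, realize_mk, realize_mk]
  exact mk_eq.2 (.ax h σ)

theorem TermModel.zeroM_eq : (zeroM z : TermModel E) = mk (zeroT z) := by
  rw [zeroT, ← funMap_mk, zeroM]
  congr 1
  funext i
  exact i.elim0

theorem TermModel.succM_mk (a : L.Term ℕ) : (succM s (mk a) : TermModel E) = mk (succT s a) :=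
  funMap_mk s _

variable {z s}

theorem Adequate.succM_ne_zeroM (hE : Adequate z s E) (e : TermModel E) :
    succM s e ≠ zeroM z := by
  obtain ⟨a, rfl⟩ := e.exists_mk
  rw [TermModel.zeroM_eq, TermModel.succM_mk, Ne, TermModel.mk_eq]
  exact hE.1 a

theorem Adequate.succM_injective (hE : Adequate z s E) :
    Function.Injective (succM s : TermModel E → TermModel E) := by
  intro e e' h
  obtain ⟨a, rfl⟩ := e.exists_mk
  obtain ⟨b, rfl⟩ := e'.exists_mk
  rw [TermModel.succM_mk, TermModel.succM_mk, TermModel.mk_eq] at h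
  exact TermModel.mk_eq.2 (hE.2 a b h)

theorem TermModel.iterate_succM (n : ℕ) :
    (succM s)^[n] (zeroM z : TermModel E) = mk ((succT s)^[n] (zeroT z)) := by
  induction n with
  | zero => exact zeroM_eq z
  | succ n ih => rw [Function.iterate_succ_apply', ih, succM_mk, Function.iterate_succ_apply']

theorem zeroT_subst (σ : ℕ → L.Term ℕ) : (zeroT z).subst σ = zeroT z := by
  simp only [zeroT, Term.subst]
  congr 1
  funext i
  exact i.elim0

theorem iterate_succT_subst (n : ℕ) (σ : ℕ → L.Term ℕ) :
    ((succT s)^[n] (zeroT z)).subst σ = (succT s)^[n] (zeroT z) := by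
  induction n with
  | zero => exact zeroT_subst σ
  | succ n ih =>
    rw [Function.iterate_succ_apply']
    conv_rhs => rw [← ih]
    rfl

/-- If a variable equalled the closed term sⁿ0, substitution would make every term equal to it, in
particular s0 and 0. -/
theorem Adequate.mk_var_ne_iterate (hE : Adequate z s E) (n : ℕ) :
    (TermModel.mk (.var 0) : TermModel E) ≠ (succM s)^[n] (zeroM z) := by
  rw [TermModel.iterate_succM, Ne, TermModel.mk_eq]
  intro h
  have key (a : L.Term ℕ) : (TermModel.mk a : TermModel E) = (succM s)^[n] (zeroM z) := by
    have := h.realize_eq TermModel.satisfies fun _ => (TermModel.mk a : TermModel E)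
    rw [TermModel.realize_mk _ fun _ => a, TermModel.realize_mk _ fun _ => a, iterate_succT_subst, ← TermModel.iterate_succM] at this
    exact this
  refine hE.1 (zeroT z) (TermModel.mk_eq.1 ?_)
  rw [key, key]

end Semantics

namespace Lam

/-! ### Variables standing for the computations of a Church integer -/

/-- An injective numbering of the terms. -/
def enc : Lam → ℕ
  | var i => 3 * i
  | app t u => 3 * Nat.pair (enc t) (enc u) + 1
  | lam t => 3 * enc t + 2

theorem enc_injective : Function.Injective enc := by
  intro t
  induction t with
  | var i => intro u h; cases u <;> simp only [enc] at h <;> first | omega | (congr 1; omega)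
  | app t u iht ihu =>
    intro w h
    cases w <;> simp only [enc] at h
    · omega
    · rw [Nat.add_right_cancel_iff, Nat.mul_right_inj three_ne_zero, Nat.pair_eq_pair] at h
      rw [iht h.1, ihu h.2]
    · omega
  | lam t ih =>
    intro w h
    cases w <;> simp only [enc] at h
    · omega
    · omega
    · rw [Nat.add_right_cancel_iff, Nat.mul_right_inj three_ne_zero] at h
      rw [ih h]

theorem FreeIn.le_enc {t : Lam} {i : ℕ} (h : FreeIn i t) : i ≤ enc t := by
  induction t generalizing i with
  | var j => cases h; simp only [enc]; omega
  | app t u iht ihu =>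
    have h1 := Nat.left_le_pair (enc t) (enc u)
    have h2 := Nat.right_le_pair (enc t) (enc u)
    simp only [enc]
    rcases h with h | h
    · have := iht h; omega
    · have := ihu h; omega
  | lam t ih =>
    have := ih h
    simp only [enc]; omega

/-- The index of a variable reserved for the computation of the integer `m` from the arguments `a`
and `b`. -/
def code (m : ℕ) (a b : Lam) : ℕ := Nat.pair m (Nat.pair (enc a) (enc b)) + 2

theorem code_inj {m m' : ℕ} {a a' b b' : Lam} (h : code m a b = code m' a' b') :
    m = m' ∧ a = a' ∧ b = b' := by
  simpa only [code, Nat.add_right_cancel_iff, Nat.pair_eq_pair, enc_injective.eq_iff] using h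

/-- The strict inequality makes the recursion in `restore` well founded and its guards harmless; the
summand 2 in `code` also keeps the variables 0 and 1 unreserved. -/
theorem FreeIn.lt_code_left {m i : ℕ} {a b : Lam} (h : FreeIn i a) : i < code m a b := by
  have h0 := h.le_enc
  have h1 := Nat.left_le_pair (enc a) (enc b)
  have h2 := Nat.right_le_pair m (Nat.pair (enc a) (enc b))
  unfold code; omega

theorem FreeIn.lt_code_right {m i : ℕ} {a b : Lam} (h : FreeIn i b) : i < code m a b := by
  have h0 := h.le_enc
  have h1 := Nat.right_le_pair (enc a) (enc b)
  have h2 := Nat.right_le_pair m (Nat.pair (enc a) (enc b))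
  unfold code; omega

/-- Weak head reduction together with the rules by which the variable `1` behaves like the Church
integer `n`. -/
inductive CodeStep (n : ℕ) : Lam → Lam → Prop
  | weak {t t' : Lam} : WStep t t' → CodeStep n t t'
  | app {t t' : Lam} (u : Lam) : CodeStep n t t' → CodeStep n (app t u) (app t' u)
  | unfold (a b : Lam) : CodeStep n (app (app (var 1) a) b) (var (code n a b))
  | zero (a b : Lam) : CodeStep n (var (code 0 a b)) a
  | succ {m : ℕ} (hm : m < n) (a b : Lam) :
      CodeStep n (var (code (m + 1) a b)) (app b (var (code m a b)))

open Classical in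
/-- The substitution that restores the computations, where `w m` computes the integer `m` from the
arguments `1` and `0`. -/
noncomputable def restore (θ : Lam) (f : ℕ) (w : ℕ → Lam) (i : ℕ) : Lam :=
  if i = 0 then var f
  else if i = 1 then θ
  else if h : ∃ c : ℕ × Lam × Lam, i = code c.1 c.2.1 c.2.2 then
    -- In the body of λxλf the variable 0 is f and 1 is x, so `b` comes before `a`. The test `j < i`
    -- only serves termination.
    subst (cons (subst (fun j => if j < i then restore θ f w j else var 0) h.choose.2.2)
      (cons (subst (fun j => if j < i then restore θ f w j else var 0) h.choose.2.1) var))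
      (w h.choose.1)
  else var 0
termination_by i

theorem restore_zero (θ : Lam) (f : ℕ) (w : ℕ → Lam) : restore θ f w 0 = var f := by
  rw [restore]; simp

theorem restore_one (θ : Lam) (f : ℕ) (w : ℕ → Lam) : restore θ f w 1 = θ := by
  rw [restore]; simp

theorem restore_code (θ : Lam) (f : ℕ) (w : ℕ → Lam) (m : ℕ) (a b : Lam) :
    restore θ f w (code m a b) =
      subst (cons (subst (restore θ f w) b) (cons (subst (restore θ f w) a) var)) (w m) := by
  have h : ∃ c : ℕ × Lam × Lam, code m a b = code c.1 c.2.1 c.2.2 := ⟨(m, a, b), rfl⟩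
  have h0 : code m a b ≠ 0 := by simp [code]
  have h1 : code m a b ≠ 1 := by simp [code]
  have ha : subst (fun j => if j < code m a b then restore θ f w j else var 0) a =
      subst (restore θ f w) a :=
    subst_congr a fun i hi => if_pos hi.lt_code_left
  have hb : subst (fun j => if j < code m a b then restore θ f w j else var 0) b =
      subst (restore θ f w) b :=
    subst_congr b fun i hi => if_pos hi.lt_code_right
  rw [restore, if_neg h0, if_neg h1, dif_pos h]
  obtain ⟨e1, e2, e3⟩ := code_inj h.choose_spec
  rw [← e1, ← e2, ← e3, ha, hb]

theorem Iterates.exists_seq {n : ℕ} {t : Lam} (h : Iterates 1 0 n t) :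
    ∃ w : ℕ → Lam, w n = t ∧ WRed (w 0) (var 1) ∧
      ∀ m < n, WRed (w (m + 1)) (Lam.app (var 0) (w m)) := by
  induction n generalizing t with
  | zero => exact ⟨fun _ => t, rfl, h, by simp⟩
  | succ n ih =>
    obtain ⟨u, h1, h2⟩ := h
    obtain ⟨w, rfl, h3, h4⟩ := ih h2
    refine ⟨Function.update w (n + 1) t, by simp, by simpa using h3, fun m hm => ?_⟩
    rw [Function.update_of_ne (by omega : m ≠ n + 1)]
    rcases Nat.lt_succ_iff_lt_or_eq.1 hm with hm | rfl
    · rw [Function.update_of_ne (by omega)]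
      exact h4 m hm
    · rw [Function.update_self]
      exact h1

/-- Each extra rule becomes a reduction θ really performs: `unfold` feeds it two arguments, while
`zero` and `succ` are instances of the reductions linking the terms `w m`. -/
theorem CodeStep.restore {n : ℕ} {θ a₀ : Lam} {w : ℕ → Lam} (h0 : WRed (w 0) (var 1))
    (hs : ∀ m < n, WRed (w (m + 1)) (Lam.app (var 0) (w m))) (hθ : WRed θ (Lam.lam a₀))
    (ha₀ : WRed a₀ (Lam.lam (w n))) (f : ℕ) {t t' : Lam} (h : CodeStep n t t') :
    WRed (subst (Lam.restore θ f w) t) (subst (Lam.restore θ f w) t') := by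
  induction h with
  | weak h => exact .single (h.subst _)
  | app u _ ih => exact ih.app _
  | unfold a b =>
    simp only [Lam.subst, restore_one, restore_code]
    refine ((hθ.app _).app _).trans (.head (.app _ (.beta _ _)) ?_)
    refine ((ha₀.subst _).app _).trans (.head (.beta _ _) ?_)
    rw [inst_subst_up]
    have : single (Lam.subst (Lam.restore θ f w) a) =
        cons (Lam.subst (Lam.restore θ f w) a) var := by
      funext i; cases i <;> rfl
    rw [this]
  | zero a b =>
    simp only [Lam.subst, restore_code]
    exact WRed.subst h0 _
  | succ hm a b =>
    simp only [Lam.subst, restore_code]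
    exact WRed.subst (hs _ hm) _

/-- The substitution depends on θ, but the `CodeStep` reductions it acts on do not; hence one τ
serves all θ. -/
theorem restore_redexes {n : ℕ} {θ : Lam} (hθ : BetaEq θ (church n)) (f : ℕ) :
    ∃ σ : ℕ → Lam, σ 0 = var f ∧ σ 1 = θ ∧
      ∀ t t', Relation.ReflTransGen (CodeStep n) t t' → WRed (subst σ t) (subst σ t') := by
  obtain ⟨a, b, h1, h2, h3⟩ := computesChurch_of_betaEq hθ
  obtain ⟨w, rfl, h4, h5⟩ := h3.exists_seq
  refine ⟨restore θ f w, restore_zero _ _ _, restore_one _ _ _, fun t t' h => ?_⟩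
  induction h with
  | refl => exact .refl
  | tail _ h ih => exact ih.trans (h.restore h4 h5 h1 h2 f)

/-- The terms whose reduction, with the variable `1` behaving like the Church integer `n`, passes
the Church integer `n` to the variable `0`. -/
def Stores (n : ℕ) (t : Lam) : Prop :=
  ∃ τ, Relation.ReflTransGen (CodeStep n) t (app (var 0) τ) ∧ BetaEq τ (church n)

/-- Storage operators are characterized by one reduction. -/
theorem Stores.isStorageOperator {T : Lam} (hT : Closed T)
    (h : ∀ n, Stores n (app (app T (var 1)) (var 0))) : IsStorageOperator T := by
  refine ⟨hT, fun n => ?_⟩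
  obtain ⟨τ, h1, h2⟩ := h n
  refine ⟨τ, h2, fun θ hθ f => ?_⟩
  obtain ⟨σ, h3, h4, h5⟩ := restore_redexes hθ f
  have h := (h5 _ _ h1).headRed
  simp only [subst, hT.subst_eq, h3, h4] at h
  exact ⟨σ, h⟩

end Lam

/-! ### Terms of storage type are storage operators -/

/-- The realizability in which the variable `1` realizes the integer `n` for the `⊥`-variables. -/
def storagePole (n : ℕ) : Pole where
  Step := Lam.CodeStep n
  bot := {t | Lam.Stores n t}
  weak := .weak
  app := .app
  expand h := fun ⟨τ, h1, h2⟩ => ⟨τ, .head h h1, h2⟩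

section

variable {L : FirstOrder.Language.{u, v}} {M : Type*} [L.Structure M] {z : L.Functions 0}
  {s : L.Functions 1}

theorem iterate_succM_injective (h0 : ∀ e : M, succM s e ≠ zeroM z)
    (hs : Function.Injective (succM s : M → M)) :
    Function.Injective fun n => (succM s)^[n] (zeroM z : M) := by
  intro m
  induction m with
  | zero =>
    intro n h
    cases n with
    | zero => rfl
    | succ n => exact absurd h.symm (by simpa only [Function.iterate_succ_apply', Function.iterate_zero, id] using h0 _)
  | succ m ih =>
    intro n h
    cases n with
    | zero => exact absurd h (by simpa only [Function.iterate_succ_apply', Function.iterate_zero, id] using h0 _)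
    | succ n =>
      simp only [Function.iterate_succ_apply'] at h
      rw [ih (hs h)]

/-- The reserved variables with index m ≤ n climb into the sets X(sᵐ0) by closure under the extra
rules. Closure under weak head expansion alone would not suffice. -/
theorem var_one_mem_natBot (n : ℕ) {a : L.Term ℕ} {v : ℕ → M} (V : PredVal M)
    (ha : a.realize v = (succM s)^[n] (zeroM z)) :
    Lam.var 1 ∈ sem (storagePole n) (natBot z s a) v V := by
  rw [natBot, mem_sem_natOfKind, ha]
  intro X hX x hx f hf
  have key : ∀ m ≤ n, Lam.var (Lam.code m x f) ∈ X ((succM s)^[m] (zeroM z)) := by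
    intro m
    induction m with
    | zero => exact fun _ => hX _ (.zero _ _) hx
    | succ m ih =>
      intro hm
      rw [Function.iterate_succ_apply']
      exact hX _ (.succ hm _ _) (hf _ _ (ih (Nat.le_of_succ_le hm)))
  exact hX _ (.unfold _ _) (key n le_rfl)

/-- The realizers of `N[a]` are equivalent to Church integers. -/
theorem betaEq_church_of_mem_nat (h0 : ∀ e : M, succM s e ≠ zeroM z)
    (hs : Function.Injective (succM s : M → M)) (P : Pole) (n : ℕ) {a : L.Term ℕ} {v : ℕ → M}
    {V : PredVal M} (ha : a.realize v = (succM s)^[n] (zeroM z)) {t : Lam}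
    (ht : t ∈ sem P (nat z s a) v V) : Lam.BetaEq t (Lam.church n) := by
  have hinj := iterate_succM_injective h0 hs
  rw [nat, mem_sem_natOfKind, ha] at ht
  -- Free variables of `t` are at most `enc t`, so `p` and `q` are fresh.
  let p := Lam.enc t + 1
  let q := Lam.enc t + 2
  -- The universal quantifier over m leaves non-standard individuals unconstrained; injectivity of
  -- the numerals makes the condition precise at standard ones.
  have h := ht (fun e => {u | ∀ m, e = (succM s)^[m] (zeroM z) → Lam.Iterates p q m u})
    (fun e u u' h hu m hm => Lam.Iterates.wRed (.single h) (hu m hm)) (Lam.var p)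
    (fun m hm => by
      obtain rfl : 0 = m := hinj hm
      exact .refl)
    (Lam.var q)
    (fun e u hu m hm => by
      cases m with
      | zero => exact absurd hm (h0 e)
      | succ m =>
        rw [Function.iterate_succ_apply'] at hm
        exact ⟨u, .refl, hu m (hs hm)⟩) n rfl
  -- Sends the fresh variables to 1 and 0 and shifts the others by 2, as if `t` stood under λxλf.
  let ρ : ℕ → ℕ := fun i => if i = p then 1 else if i = q then 0 else i + 2
  have h1 := h.rename ρ
  have hp : ρ p = 1 := by simp [ρ]
  have hq : ρ q = 0 := by simp [ρ, p, q]
  have hρ : Lam.rename ρ t = Lam.rename (· + 2) t := Lam.rename_congr fun i hi => by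
    have := hi.le_enc
    have h1 : i ≠ p := by omega
    have h2 : i ≠ q := by omega
    simp only [ρ, if_neg h1, if_neg h2]
  simp only [Lam.rename, hp, hq, hρ] at h1
  exact (Lam.computesChurch_of_iterates_rename h1).betaEq

theorem isStorageOperator_of_typing {E : Set (L.Term ℕ × L.Term ℕ)} (hE : Adequate z s E)
    {T : Lam} (hT : T.Closed) (h : Typing E [] T (storageType z s)) : T.IsStorageOperator := by
  refine Lam.Stores.isStorageOperator hT fun n => ?_
  let V : PredVal (TermModel E) := fun _ _ _ _ => Set.univ
  let v : ℕ → TermModel E := fun _ => zeroM z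
  have hT := h.sound_closed (storagePole n) TermModel.satisfies v (V := V)
    fun _ _ _ _ => Pole.admits_univ _ _
  have h1 := hT ((succM s)^[n] (zeroM z)) (Lam.var 1) (var_one_mem_natBot n V rfl)
  -- The variable 0 realizes ¬N[sⁿ0]: applied to a realizer τ it already has the form required by
  -- `Stores`.
  exact h1 (Lam.var 0) fun τ hτ =>
    ⟨τ, .refl, betaEq_church_of_mem_nat hE.succM_ne_zeroM hE.succM_injective _ n rfl hτ⟩

end

/-! ### The Gödel translations do not type the operators `opT` and `opT'` -/

namespace Lam

/-- The applications of the variable `0` to at least three arguments. -/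
inductive LongSpine : Lam → Prop
  | three (a b c : Lam) : LongSpine (app (app (app (var 0) a) b) c)
  | app {t : Lam} (u : Lam) : LongSpine t → LongSpine (app t u)

theorem LongSpine.not_wStep {t u : Lam} (h : LongSpine t) : ¬ WStep t u := by
  induction h generalizing u with
  | three a b c =>
    intro h
    cases h with | app _ h => cases h with | app _ h => cases h with | app _ h => cases h
  | app v h ih =>
    intro h'
    cases h' with
    | beta => cases h
    | app _ h' => exact ih h'

/-- Weak head reduction is deterministic and both shapes are normal for it, yet they have different
numbers of arguments. -/
theorem not_longSpine_of_wRed {t a b u : Lam} (h : WRed t (app (app (var 0) a) b))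
    (hu : WRed t u) : ¬ LongSpine u := by
  intro hs
  have e : u = app (app (var 0) a) b := by
    rcases h.confluent hu with h | h
    · rcases h.app_inv with ⟨t', rfl, h'⟩ | ⟨c, h', _⟩
      · rw [h'.eq_of_app_var]
      · cases h'.eq_of_app_var
    · rcases Relation.ReflTransGen.cases_head h with h | ⟨_, h, _⟩
      · exact h
      · exact absurd h hs.not_wStep
  subst e
  cases hs with | app _ hs => cases hs with | app _ hs => cases hs

/-- All that the negative result needs from `opT` and `opT'`: their first argument reaches the head
with exactly two arguments. -/
theorem wRed_lam_lam_app (t t' u v : Lam) :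
    ∃ a b, WRed (app (app (lam (lam (app (app (var 1) t) t'))) u) v) (app (app u a) b) := by
  have h : WRed (app (app (lam (lam (app (app (var 1) t) t'))) u) v)
      (app (app (inst (rename Nat.succ u) v) (inst (subst (up (single u)) t) v))
        (inst (subst (up (single u)) t') v)) :=
    .head (.app _ (.beta _ _)) (.single (.beta _ _))
  have e : inst (rename Nat.succ u) v = u := by
    rw [inst, subst_rename]
    exact subst_var u
  rw [e] at h
  exact ⟨_, _, h⟩

end Lam

/-- The realizability in which all predicate variables range over the sets closed under weak head
expansion. -/
def weakPole (O : Set Lam) (hO : ∀ {t t'}, Lam.WStep t t' → t' ∈ O → t ∈ O) : Pole where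
  Step := Lam.WStep
  bot := O
  weak := id
  app := .app
  expand := hO

section

variable {L : FirstOrder.Language.{u, v}} {M : Type*} [L.Structure M] {z : L.Functions 0}
  {s : L.Functions 1}

/-- Further arguments keep a spine long, so it realizes whatever ends in ⊥. -/
theorem longSpine_mem_sem {P : Pole} (hP : ∀ t, Lam.LongSpine t → t ∈ P.bot) {G : Formula L}
    (hG : G.EndsInBot) (v : ℕ → M) (V : PredVal M) {t : Lam} (ht : Lam.LongSpine t) :
    t ∈ sem P G v V := by
  induction G generalizing v V t with
  | bot => exact hP t ht
  | rel => exact hG.elim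
  | pvar => exact hG.elim
  | imp A B _ ih => exact fun u _ => ih hG v V (ht.app u)
  | all₁ A ih => exact fun e => ih hG _ V ht
  | all₂ k n A ih => exact fun X _ => ih hG v _ ht

/-- The formulas `∀ … ∀ ⊥`. -/
def Formula.IsAllBot : Formula L → Prop
  | .bot => True
  | .all₁ A => A.IsAllBot
  | .all₂ _ _ A => A.IsAllBot
  | _ => False

theorem Formula.IsAllBot.sem_eq [Nonempty M] (P : Pole) {G : Formula L} (hG : G.IsAllBot)
    (v : ℕ → M) (V : PredVal M) : sem P G v V = P.bot := by
  induction G generalizing v V with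
  | bot => rfl
  | rel => exact hG.elim
  | pvar => exact hG.elim
  | imp => exact hG.elim
  | all₁ A ih => simp only [sem, ih hG, forall_const]; rfl
  | all₂ k n A ih =>
    simp only [sem, ih hG]
    ext t
    exact ⟨fun h => h (fun _ => Set.univ) fun _ => P.admits_univ k, fun h _ _ => h⟩

/-- Some arrow occurs in `G` before its final ⊥; it supplies the third argument. -/
theorem spine_two_mem_sem {P : Pole} (hP : ∀ t, Lam.LongSpine t → t ∈ P.bot) {G : Formula L}
    (hG : G.EndsInBot) (hG' : ¬ G.IsAllBot) (v : ℕ → M) (V : PredVal M) (a b : Lam) :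
    Lam.app (Lam.app (Lam.var 0) a) b ∈ sem P G v V := by
  induction G generalizing v V with
  | bot => exact absurd trivial hG'
  | rel => exact hG.elim
  | pvar => exact hG.elim
  | imp A B _ _ => exact fun u _ => longSpine_mem_sem hP (G := B) hG v V (.three a b u)
  | all₁ A ih => exact fun e => ih hG hG' _ V
  | all₂ k n A ih => exact fun X _ => ih hG hG' v _

theorem mem_sem_foldr_all₂ (P : Pole) {t : Lam} {A : Formula L} {v : ℕ → M}
    (h : ∀ V : PredVal M, t ∈ sem P A v V) (ns : List ℕ) (V : PredVal M) :
    t ∈ sem P (ns.foldr (Formula.all₂ Kind.ordinary) A) v V := by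
  induction ns generalizing V with
  | nil => exact h V
  | cons n ns ih => exact fun X _ => ih _

/-- Take X(e) to be everything at numerals and empty elsewhere: a realizer would make the variable a
numeral. -/
theorem sem_nat_eq_empty {E : Set (L.Term ℕ × L.Term ℕ)} (hE : Adequate z s E) (P : Pole)
    {a : L.Term ℕ} {v : ℕ → TermModel E} (V : PredVal (TermModel E))
    (ha : a.realize v = TermModel.mk (.var 0)) : sem P (nat z s a) v V = ∅ := by
  refine Set.eq_empty_of_forall_notMem fun t ht => ?_
  rw [nat, mem_sem_natOfKind, ha] at ht
  obtain ⟨n, hn⟩ := ht (fun e => {_u | ∃ n, e = (succM s)^[n] (zeroM z)})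
    (fun _ _ _ _ h => h) (Lam.var 0) ⟨0, rfl⟩ (Lam.var 0)
    (fun e _ ⟨n, hn⟩ => ⟨n + 1, by rw [Function.iterate_succ_apply', ← hn]⟩)
  exact hE.mk_var_ne_iterate n hn

theorem not_typing_storageTypeGodel {E : Set (L.Term ℕ × L.Term ℕ)} (hE : Adequate z s E)
    {T : Lam} (hT : ∀ u v, ∃ a b, Lam.WRed (Lam.app (Lam.app T u) v) (Lam.app (Lam.app u a) b))
    (ns : List ℕ) {G : Formula L} (hG : G.EndsInBot) :
    ¬ Typing E [] T (storageTypeGodel z s ns G) := by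
  intro h
  let V : PredVal (TermModel E) := fun _ _ _ _ => Set.univ
  let v : ℕ → TermModel E := fun _ => zeroM z
  have : Nonempty (TermModel E) := ⟨zeroM z⟩
  have key (P : Pole) (hν : ∀ v V, Lam.var 0 ∈
      sem (M := TermModel E) P (natGodel z s ns G (.var 0)) v V) :
      Lam.app (Lam.app T (Lam.var 0)) (Lam.var 1) ∈ P.bot := by
    refine h.sound_closed P TermModel.satisfies v (V := V) (fun _ _ _ _ => P.admits_univ _)
      (TermModel.mk (.var 0)) _ (hν _ _) _ fun t ht => ?_
    rw [sem_nat_eq_empty hE P V rfl] at ht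
    exact ht.elim
  by_cases hG' : G.IsAllBot
  · refine key (weakPole ∅ fun _ h => h) fun v V => mem_sem_foldr_all₂ _ (fun V u hu => ?_) ns V
    rw [sem_inst₁, hG'.sem_eq] at hu
    -- With ⊥ empty, G[0] has no realizer, so the variable 0 realizes N^g vacuously.
    exact hu.elim
  · let P := weakPole {t | ∃ u, Lam.WRed t u ∧ Lam.LongSpine u}
      fun h ⟨u, hu, hs⟩ => ⟨u, .head h hu, hs⟩
    have hP (t : Lam) (ht : Lam.LongSpine t) : t ∈ P.bot := ⟨t, .refl, ht⟩
    obtain ⟨u, hu, hs⟩ := key P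
      fun v V => mem_sem_foldr_all₂ _ (fun V a _ b _ => by
        rw [sem_inst₁]
        exact spine_two_mem_sem hP hG hG' _ _ a b) ns V
    obtain ⟨a, b, hab⟩ := hT (Lam.var 0) (Lam.var 1)
    exact Lam.not_longSpine_of_wRed hab hu hs

end

section

variable {L : FirstOrder.Language.{u, v}} {z : L.Functions 0} {s : L.Functions 1}

/-! ### Typing the storage operators -/

variable (s) in
/-- `∀X {X(b), ∀y (X(y) → X(sy)) → X(a)}` with `X` a unary predicate variable of kind `k`. -/
def iterOfKind (k : Kind) (b a : L.Term ℕ) : Formula L :=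
  .all₂ k 1 (.imp (.pvar k 1 0 fun _ => b)
    (.imp (.all₁ (.imp (.pvar k 1 0 fun _ => .var 0) (.pvar k 1 0 fun _ => succT s (.var 0))))
      (.pvar k 1 0 fun _ => a)))

theorem natOfKind_eq (k : Kind) (a : L.Term ℕ) :
    natOfKind z s k a = iterOfKind s k (zeroT z) a := rfl

theorem iterOfKind_subst₁ (k : Kind) (b a : L.Term ℕ) (σ : ℕ → L.Term ℕ) :
    (iterOfKind s k b a).subst₁ σ = iterOfKind s k (b.subst σ) (a.subst σ) := rfl

theorem iterOfKind_rename₂ (k : Kind) (b a : L.Term ℕ) (ρ : Kind → ℕ → ℕ → ℕ) :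
    (iterOfKind s k b a).rename₂ ρ = iterOfKind s k b a := by
  simp [iterOfKind, Formula.rename₂, Formula.upRen₂]

/-- The formula `G[b], ∀y (G[y] → G[sy]) → G[a]`. -/
def iterAt (s : L.Functions 1) (G : L.Term ℕ → Formula L) (G' : L.Term ℕ → Formula L)
    (b a : L.Term ℕ) : Formula L :=
  .imp (G b) (.imp (.all₁ (.imp (G' (.var 0)) (G' (succT s (.var 0))))) (G a))

/-- The step clause lies under ∀y, so there the parameters of `G` are raised by one; hence two
versions of `G` in `iterAt`. -/
theorem iterOfKind_inst₂ (k : Kind) (b a : L.Term ℕ) (G : Formula L) :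
    Formula.inst₂ k 1 (.imp (.pvar k 1 0 fun _ => b)
      (.imp (.all₁ (.imp (.pvar k 1 0 fun _ => .var 0) (.pvar k 1 0 fun _ => succT s (.var 0))))
        (.pvar k 1 0 fun _ => a))) G =
    iterAt s (fun t => G.applyArgs fun _ : Fin 1 => t)
      (fun t => (G.subst₁ fun m => .var (if m < 1 then m else m + 1)).applyArgs
        fun _ : Fin 1 => t) b a := by
  simp [iterAt, Formula.inst₂, Formula.subst₂, Formula.up₂₁, Formula.single₂]

variable {E : Set (L.Term ℕ × L.Term ℕ)} {Γ : List (Formula L)}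

theorem Typing.iter_spec {t : Lam} {b a : L.Term ℕ} (G : Formula L)
    (h : Typing E Γ t (iterOfKind s .ordinary b a)) :
    Typing E Γ t (iterAt s (fun t => G.applyArgs fun _ : Fin 1 => t)
      (fun t => (G.subst₁ fun m => .var (if m < 1 then m else m + 1)).applyArgs
        fun _ : Fin 1 => t) b a) := by
  rw [← iterOfKind_inst₂ .ordinary]
  exact h.spec₂ G

theorem Typing.iter_specBot {t : Lam} {b a : L.Term ℕ} (G : Formula L) (hG : G.IsBotType)
    (h : Typing E Γ t (iterOfKind s .bottom b a)) :
    Typing E Γ t (iterAt s (fun t => G.applyArgs fun _ : Fin 1 => t)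
      (fun t => (G.subst₁ fun m => .var (if m < 1 then m else m + 1)).applyArgs
        fun _ : Fin 1 => t) b a) := by
  rw [← iterOfKind_inst₂ .bottom]
  exact h.specBot G hG

theorem Typing.iter_gen {t : Lam} {b a : L.Term ℕ}
    (h : Typing E ((.all₁ (.imp (.pvar .ordinary 1 0 fun _ => .var 0)
      (.pvar .ordinary 1 0 fun _ => succT s (.var 0)))) :: (.pvar .ordinary 1 0 fun _ => b) ::
        Γ.map (Formula.shift₂ .ordinary 1)) t (.pvar .ordinary 1 0 fun _ => a)) :
    Typing E Γ (.lam (.lam t)) (iterOfKind s .ordinary b a) :=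
  .gen₂ _ _ (.lam (.lam h))

theorem Typing.iter_pvar {t : Lam} {b a : L.Term ℕ}
    (h : Typing E Γ t (iterOfKind s .ordinary b a)) :
    Typing E Γ t (iterAt s (fun t => .pvar .ordinary 1 0 fun _ => t)
      (fun t => .pvar .ordinary 1 0 fun _ => t) b a) := by
  simpa [Formula.applyArgs, Formula.subst₁] using
    h.iter_spec (.pvar .ordinary 1 0 fun _ => .var 0)

theorem Typing.step_spec {t : Lam} (a : L.Term ℕ)
    (h : Typing E Γ t (.all₁ (.imp (.pvar .ordinary 1 0 fun _ => .var 0)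
      (.pvar .ordinary 1 0 fun _ => succT s (.var 0))))) :
    Typing E Γ t (.imp (.pvar .ordinary 1 0 fun _ => a) (.pvar .ordinary 1 0 fun _ => succT s a)) :=
  h.spec₁ a

theorem typing_church_zero (a : L.Term ℕ) :
    Typing E Γ (Lam.church 0) (iterOfKind s .ordinary a a) :=
  .iter_gen (.var rfl)

theorem typing_succ (b a : L.Term ℕ) :
    Typing E Γ Lam.succ (.imp (iterOfKind s .ordinary b a)
      (iterOfKind s .ordinary b (succT s a))) := by
  refine .lam (.iter_gen (.app (.step_spec a (.var rfl)) ?_))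
  refine .app (.app (Typing.iter_pvar (b := b) (a := a) ?_) (.var rfl)) (.var rfl)
  rw [← iterOfKind_rename₂ (s := s)]
  exact .var rfl

/-- The extra application acts on the base, so this successor moves the starting point from sb down
to b instead of raising the endpoint. -/
theorem typing_succ' (b a : L.Term ℕ) :
    Typing E Γ Lam.succ' (.imp (iterOfKind s .ordinary (succT s b) a)
      (iterOfKind s .ordinary b a)) := by
  refine .lam (.iter_gen ?_)
  refine .app (.app (Typing.iter_pvar (b := succT s b) (a := a) ?_)
    (.app (.step_spec b (.var rfl)) (.var rfl))) (.var rfl)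
  rw [← iterOfKind_rename₂ (s := s)]
  exact .var rfl

theorem typing_storage₁ (i : ℕ) : Typing E Γ (Lam.storage₁ Lam.succ)
    (.imp (natBot z s (.var i)) (nat z s (.var i)).neg.neg) := by
  have h : Typing E (natBot z s (.var i) :: Γ) (.var 0)
      (iterAt s (fun t => (nat z s t).neg.neg) (fun t => (nat z s t).neg.neg) (zeroT z)
        (.var i)) := by
    -- The ⊥-variable becomes y ↦ ¬¬N[y].
    have := Typing.iter_specBot (s := s) (nat z s (.var 0)).neg.neg trivial
      (.var (E := E) (Γ := natBot z s (.var i) :: Γ) (i := 0) rfl)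
    simpa [nat, natOfKind_eq, Formula.neg, Formula.applyArgs, Formula.subst₁, iterOfKind_subst₁,
      zeroT_subst] using this
  refine .lam (.app (.app h (.lam (.app (.var rfl) (typing_church_zero _)))) ?_)
  refine .gen₁ (.lam (.lam (.app (.var rfl) (.lam (.app (.var rfl) ?_)))))
  exact .app (typing_succ _ _) (.var rfl)

theorem typing_storage₂ (i : ℕ) : Typing E Γ (Lam.storage₂ Lam.succ')
    (.imp (natBot z s (.var i)) (nat z s (.var i)).neg.neg) := by
  have h : Typing E ((nat z s (.var i)).neg :: natBot z s (.var i) :: Γ) (.var 1)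
      (iterAt s (fun t => (iterOfKind s .ordinary t (.var i)).neg)
        (fun t => (iterOfKind s .ordinary t (.var (i + 1))).neg) (zeroT z) (.var i)) := by
    -- The ⊥-variable becomes y ↦ ¬(iteration from y to x): at y = 0 this is the type of f, and at y
    -- = x it refutes the type of the Church integer 0.
    have := Typing.iter_specBot (s := s) (iterOfKind s .ordinary (.var 0) (.var (i + 1))).neg trivial
      (.var (E := E) (Γ := (nat z s (.var i)).neg :: natBot z s (.var i) :: Γ) (i := 1) rfl)
    simpa [Formula.neg, Formula.applyArgs, Formula.subst₁, iterOfKind_subst₁] using this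
  refine .lam (.lam (.app (.app (.app h (.var rfl)) ?_) (typing_church_zero _)))
  refine .gen₁ (.lam (.lam (.app (.var rfl) ?_)))
  exact .app (typing_succ' _ _) (.var rfl)

theorem typing_of_storageType {t : Lam} (h : Typing E
      [(nat z s (.var 0)).neg, natBot z s (.var 0)] t .bot) :
    Typing E [] (.lam (.lam t)) (storageType z s) :=
  .gen₁ (.lam (.lam h))

theorem typing_natBot_bot :
    Typing E ((nat z s (.var 0)).neg :: natBot z s (.var 0) :: Γ) (.var 1)
      (.imp .bot (.imp (.all₁ (.imp .bot .bot)) .bot)) :=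
  Typing.iter_specBot (s := s) .bot trivial (.var rfl)

theorem typing_opT {S : Lam} (hS : ∀ (Γ : List (Formula L)) (i : ℕ), Typing E Γ S
      (.imp (natBot z s (.var i)) (nat z s (.var i)).neg.neg)) :
    Typing E [] (Lam.opT S) (storageType z s) :=
  typing_of_storageType (.app (.app typing_natBot_bot
    (.app (.app (hS _ 0) (.var rfl)) (.var rfl))) (.gen₁ (.lam (.var rfl))))

theorem typing_opT' {S S' : Lam}
    (hS : ∀ (Γ : List (Formula L)) (i : ℕ), Typing E Γ S
      (.imp (natBot z s (.var i)) (nat z s (.var i)).neg.neg))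
    (hS' : ∀ (Γ : List (Formula L)) (i : ℕ), Typing E Γ S'
      (.imp (natBot z s (.var i)) (nat z s (.var i)).neg.neg)) :
    Typing E [] (Lam.opT' S S') (storageType z s) := by
  refine typing_of_storageType (.app (.app typing_natBot_bot
    (.app (.app (hS _ 0) (.var rfl)) (.var rfl))) (.gen₁ (.lam ?_)))
  have h (k : Kind) : (natOfKind z s k (.var 0)).shift₁ = natOfKind z s k (.var 1) := by
    rw [natOfKind_eq, Formula.shift₁, iterOfKind_subst₁, zeroT_subst]; rfl
  -- Under the vacuous ∀y the individual variable x has index 1.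
  refine .app (.app (hS' _ 1) (.var ?_)) (.var ?_)
  · exact congrArg some (h _)
  · exact congrArg (fun A => some (Formula.neg A)) (h _)

end

end AF2

theorem theorem5p1 {L : FirstOrder.Language.{u, v}} (z : L.Functions 0) (s : L.Functions 1)
    (E : Set (L.Term ℕ × L.Term ℕ)) (hE : AF2.Adequate z s E) :
    (∀ T : AF2.Lam, T.Closed → AF2.Typing E [] T (AF2.storageType z s) → T.IsStorageOperator) ∧
    (∀ S ∈ ({AF2.Lam.storage₁ AF2.Lam.succ, AF2.Lam.storage₂ AF2.Lam.succ'} : Set AF2.Lam),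
      ∀ S' ∈ ({AF2.Lam.storage₁ AF2.Lam.succ, AF2.Lam.storage₂ AF2.Lam.succ'} : Set AF2.Lam),
        AF2.Typing E [] (AF2.Lam.opT S) (AF2.storageType z s) ∧
        AF2.Typing E [] (AF2.Lam.opT' S S') (AF2.storageType z s)) ∧
    (∀ S ∈ ({AF2.Lam.storage₁ AF2.Lam.succ, AF2.Lam.storage₂ AF2.Lam.succ,
          AF2.Lam.storage₂ AF2.Lam.succ'} : Set AF2.Lam),
      ∀ S' ∈ ({AF2.Lam.storage₁ AF2.Lam.succ, AF2.Lam.storage₂ AF2.Lam.succ,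
          AF2.Lam.storage₂ AF2.Lam.succ'} : Set AF2.Lam),
        ∀ (ns : List ℕ) (G : AF2.Formula L), G.EndsInBot →
          ¬ AF2.Typing E [] (AF2.Lam.opT S) (AF2.storageTypeGodel z s ns G) ∧
          ¬ AF2.Typing E [] (AF2.Lam.opT' S S') (AF2.storageTypeGodel z s ns G)) := by
  have typed : ∀ S ∈ ({AF2.Lam.storage₁ AF2.Lam.succ, AF2.Lam.storage₂ AF2.Lam.succ'} :
      Set AF2.Lam), ∀ (Γ : List (AF2.Formula L)) (i : ℕ), AF2.Typing E Γ S
        (.imp (AF2.natBot z s (.var i)) (AF2.nat z s (.var i)).neg.neg) := by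
    rintro S (rfl | rfl) Γ i
    · exact AF2.typing_storage₁ i
    · exact AF2.typing_storage₂ i
  exact ⟨fun T hT h => AF2.isStorageOperator_of_typing hE hT h,
    fun S hS S' hS' => ⟨AF2.typing_opT (typed S hS), AF2.typing_opT' (typed S hS) (typed S' hS')⟩,
    fun S _ S' _ ns G hG =>
      ⟨AF2.not_typing_storageTypeGodel hE (fun _ _ => AF2.Lam.wRed_lam_lam_app _ _ _ _) ns hG,
        AF2.not_typing_storageTypeGodel hE (fun _ _ => AF2.Lam.wRed_lam_lam_app _ _ _ _) ns hG⟩⟩
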